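/- Let $N\ge 1$, $R=\mathbb Z/N\mathbb Z$ and $\omega=\exp(2\pi i/N)$. Let $\mathcal A=\mathbb Q\langle x,y_a\mid a\in R\rangle$ be the non-commutative polynomial algebra, $\mathcal A^1=\mathbb Q+\sum_{a\in R}\mathcal A y_a$, $\mathcal A^0=\mathbb Q+\sum_{a\in R}x\mathcal A y_a+\sum_{a,b\in R,\,b\ne 0}y_b\mathcal A y_a$, and $z_{k,a}=x^{k-1}y_a$ for $k\ge 1$, $a\in R$. The words $z_{k_1,a_1}\cdots z_{k_n,a_n}$ ($n\ge 0$) form a basis of $\mathcal A^1$. Let * $\mathcal L_\ast:\mathcal A^0\to\mathbb C$ be the $\mathbb Q$-linear map with $\mathcal L_\ast(1)=1$ and $$\mathcal L_\ast(z_{k_1,a_1}\cdots z_{k_n,a_n})=L_\ast(k_1,\dots,k_n;a_1,\dots,a_n)=\sum_{m_1>\cdots>m_n>0}\frac{\omega^{a_1m_1+\cdots+a_nm_n}}{m_1^{k_1}\cdots m_n^{k_n}},$$ the sum being the limit for $M\to\infty$ of the partial sums over $M>m_1>\cdots>m_n>0$, which exists whenever $k_1\ge 2$ or $a_1\ne 0$;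 * $\mathcal I:\mathcal A^1\to\mathcal A^1$ be the invertible $\mathbb Q$-linear map with $\mathcal I(z_{k_1,a_1}z_{k_2,a_2}\cdots z_{k_n,a_n})=z_{k_1,a_1}z_{k_2,a_1+a_2}\cdots z_{k_n,a_1+\cdots+a_n}$; * $\ast$ be the $\mathbb Q$-bilinear product on $\mathcal A^1$ with $1\ast w=w\ast 1=w$ and $z_{k,a}w_1\ast z_{l,b}w_2=z_{k,a}(w_1\ast z_{l,b}w_2)+z_{l,b}(z_{k,a}w_1\ast w_2)+z_{k+l,a+b}(w_1\ast w_2)$ for words $w,w_1,w_2$ of $\mathcal A^1$; * ш be the shuffle product on $\mathcal A$, i.e. the $\mathbb Q$-bilinear product with $1$ ш $w=w$ ш $1=w$ and $uw_1$ ш $vw_2=u(w_1$ ш $vw_2)+v(uw_1$ ш $w_2)$ for letters $u,v$ and words $w,w_1,w_2$; it maps $\mathcal A^1\times\mathcal A^1$ to $\mathcal A^1$. Let $k,n$ be integers with $n\ge 2$ and $k\ge n+1$, and let $a,a_1,\dots,a_{n-1}\in R$. Put $d_1=a_1$ and $d_j=a_j-a_{j-1}$ for $2\le j\le n-1$. In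 all sums below the $k_j$ and $l$ are integers $\geq 1$. Then the sum $$\sum_{\substack{l+k_1+\cdots+k_{n-1}=k\\ k_1\ge 2}}\Bigl(\mathcal I^{-1}\bigl(z_{l,a}\text{ ш }z_{k_1,a_1}\cdots z_{k_{n-1},a_{n-1}}\bigr)-\mathcal I^{-1}(z_{l,a})\ast\mathcal I^{-1}\bigl(z_{k_1,a_1}\cdots z_{k_{n-1},a_{n-1}}\bigr)\Bigr)$$ is equal to $$\begin{aligned} &\sum_{\substack{k_1+\cdots+k_n=k\\ k_2\ge 2}}2^{k_1-1}\,z_{k_1,a}z_{k_2,a_1-a}z_{k_3,d_2}\cdots z_{k_n,d_{n-1}} +\sum_{\substack{k_1+\cdots+k_n=k\\ k_1\ge 2,\,k_2=1}}(2^{k_1-1}-1)\,z_{k_1,a}z_{k_2,a_1-a}z_{k_3,d_2}\cdots z_{k_n,d_{n-1}}\\ &+\sum_{i=2}^{n-1}\sum_{\substack{k_1+\cdots+k_n=k\\ k_1\ge 2}}\bigl(2^{k_1+\cdots+k_i-i}-2^{k_2+\cdots+k_i-(i-1)}\bigr)z_{k_1,d_1}\cdots z_{k_{i-1},d_{i-1}}\,z_{k_i,a-a_{i-1}}z_{k_{i+1},a_i-a}\,z_{k_{i+2},d_{i+1}}\cdots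 z_{k_n,d_{n-1}}\\ &+\sum_{\substack{k_1+\cdots+k_n=k\\ k_1\ge 2}}\bigl(2^{k_1+\cdots+k_{n-1}-(n-1)}-2^{k_2+\cdots+k_{n-1}-(n-2)}\bigr)z_{k_1,d_1}\cdots z_{k_{n-1},d_{n-1}}z_{k_n,a-a_{n-1}}\\ &-\sum_{\substack{k_1+\cdots+k_n=k\\ k_2\ge 2}}z_{k_1,a}z_{k_2,d_1}z_{k_3,d_2}\cdots z_{k_n,d_{n-1}} -\sum_{i=1}^{n-1}\sum_{\substack{k_1+\cdots+k_n=k\\ k_1\ge 2}}z_{k_1,d_1}\cdots z_{k_i,d_i}\,z_{k_{i+1},a}\,z_{k_{i+2},d_{i+1}}\cdots z_{k_n,d_{n-1}}\\ &-\sum_{\substack{k_1+\cdots+k_{n-1}=k\\ k_1\ge 2}}(k_1-2)\,z_{k_1,a+a_1}z_{k_2,d_2}\cdots z_{k_{n-1},d_{n-1}}\\ &-\sum_{i=2}^{n-1}\sum_{\substack{k_1+\cdots+k_{n-1}=k\\ k_1\ge 2}}(k_i-1)\,z_{k_1,d_1}\cdots z_{k_{i-1},d_{i-1}}\,z_{k_i,a+a_i-a_{i-1}}\,z_{k_{i+1},d_{i+1}}\cdots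 z_{k_{n-1},d_{n-1}}. \end{aligned}$$ Moreover, this combination of words belongs to $\mathcal A^0$ and to $\ker(\mathcal L_\ast)$. -/

import Mathlib

noncomputable section

namespace MultipleL

/-- The alphabet `{x, y_a | a ∈ ℤ/Nℤ}`. -/
inductive Letter (N : ℕ) : Type
  | x : Letter N
  | y : ZMod N → Letter N

/-- The non-commutative polynomial algebra `𝒜 = ℚ⟨x, y_a | a ∈ ℤ/Nℤ⟩`. -/
abbrev A (N : ℕ) : Type := FreeAlgebra ℚ (Letter N)

variable {N : ℕ}

/-- The generator `x` of `𝒜`. -/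
def X : A N := FreeAlgebra.ι ℚ Letter.x

/-- The generator `y_a` of `𝒜`. -/
def Y (a : ZMod N) : A N := FreeAlgebra.ι ℚ (Letter.y a)

/-- A word in the letters, as an element of `𝒜`. -/
def word (w : List (Letter N)) : A N := (w.map (FreeAlgebra.ι ℚ)).prod

/-- `z_{k,a} = x^{k-1} y_a` (used for `k ≥ 1` only). -/
def z (k : ℕ) (a : ZMod N) : A N := X ^ (k - 1) * Y a

variable (N) in
/-- `𝒜¹ = ℚ + ∑_a 𝒜 y_a`. -/
def A1 : Submodule ℚ (A N) :=
  Submodule.span ℚ ({1} ∪ {p | ∃ (u : A N) (a : ZMod N), p = u * Y a})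

variable (N) in
/-- `𝒜⁰ = ℚ + ∑_a x 𝒜 y_a + ∑_{a, b, b ≠ 0} y_b 𝒜 y_a`. -/
def A0 : Submodule ℚ (A N) :=
  Submodule.span ℚ ({1} ∪ {p | ∃ (u : A N) (a : ZMod N), p = X * u * Y a} ∪
    {p | ∃ (u : A N) (a b : ZMod N), b ≠ 0 ∧ p = Y b * u * Y a})

theorem A0_le_A1 : A0 N ≤ A1 N := by
  refine Submodule.span_le.2 ?_
  rintro p ((hp | ⟨u, a, rfl⟩) | ⟨u, a, b, -, rfl⟩)
  · exact Submodule.subset_span (Or.inl hp)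
  · exact Submodule.subset_span (Or.inr ⟨X * u, a, rfl⟩)
  · exact Submodule.subset_span (Or.inr ⟨Y b * u, a, rfl⟩)

/-- A list `[(k₁, a₁), …, (kₙ, aₙ)]`, standing for the word `z_{k₁,a₁} ⋯ z_{kₙ,aₙ}`. -/
abbrev ZWord (N : ℕ) : Type := List (ℕ+ × ZMod N)

/-- The element `z_{k₁,a₁} ⋯ z_{kₙ,aₙ}` of `𝒜`. -/
def ofZWord (w : ZWord N) : A N := (w.map fun p => z (p.1 : ℕ) p.2).prod

/-! ### The words `z_{k₁,a₁} ⋯ z_{kₙ,aₙ}` form a basis of `𝒜¹` -/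

/-- The letters of `z_{k₁,a₁} ⋯ z_{kₙ,aₙ}`. -/
def letters : ZWord N → List (Letter N)
  | [] => []
  | (k, a) :: w => List.replicate ((k : ℕ) - 1) Letter.x ++ Letter.y a :: letters w

theorem word_letters (w : ZWord N) : word (letters w) = ofZWord w := by
  induction w with
  | nil => rfl
  | cons p w ih =>
    obtain ⟨k, a⟩ := p
    have h : word (letters ((k, a) :: w)) = z (k : ℕ) a * word (letters w) := by
      simp [letters, word, z, X, Y, mul_assoc]
    rw [h, ih]
    simp [ofZWord]

theorem replicate_x_append_inj {m m' : ℕ} {a a' : ZMod N} {u u' : List (Letter N)}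
    (h : List.replicate m Letter.x ++ Letter.y a :: u =
      List.replicate m' Letter.x ++ Letter.y a' :: u') : m = m' ∧ a = a' ∧ u = u' := by
  induction m generalizing m' with
  | zero =>
    cases m' with
    | zero => simpa using h
    | succ m' => simp [List.replicate_succ] at h
  | succ m ih =>
    cases m' with
    | zero => simp [List.replicate_succ] at h
    | succ m' =>
      simp only [List.replicate_succ, List.cons_append, List.cons.injEq, true_and] at h
      obtain ⟨h1, h2⟩ := ih h
      exact ⟨by rw [h1], h2⟩

theorem letters_injective : Function.Injective (letters (N := N)) := by
  intro w
  induction w with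
  | nil =>
    rintro (_ | ⟨⟨k, a⟩, w'⟩) h
    · rfl
    · simp [letters] at h
  | cons p w ih =>
    obtain ⟨k, a⟩ := p
    rintro (_ | ⟨⟨k', a'⟩, w'⟩) h
    · simp [letters] at h
    · obtain ⟨h1, h2, h3⟩ := replicate_x_append_inj h
      have hk : k = k' := by
        have := k.pos
        have := k'.pos
        exact PNat.eq (by omega)
      rw [hk, h2, ih h3]

theorem exists_letters (u : List (Letter N)) (a : ZMod N) :
    ∃ w : ZWord N, w ≠ [] ∧ letters w = u ++ [Letter.y a] := by
  induction u with
  | nil => exact ⟨[(1, a)], by simp, by simp [letters]⟩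
  | cons c u ih =>
    obtain ⟨w, hw, h⟩ := ih
    cases c with
    | y b => exact ⟨(1, b) :: w, by simp, by simp [letters, h]⟩
    | x =>
      match w, hw with
      | (k, b) :: w, _ =>
        refine ⟨(k + 1, b) :: w, by simp, ?_⟩
        have hk : ((k + 1 : ℕ+) : ℕ) - 1 = ((k : ℕ) - 1) + 1 := by
          have := k.pos
          simp
          omega
        rw [List.cons_append, ← h]
        simp only [letters, hk, List.replicate_succ, List.cons_append]

theorem basisFreeMonoid_eq_word (w : List (Letter N)) :
    FreeAlgebra.basisFreeMonoid ℚ (Letter N) (FreeMonoid.ofList w) = word w := by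
  simp [FreeAlgebra.basisFreeMonoid, word, FreeAlgebra.equivMonoidAlgebraFreeMonoid,
    MonoidAlgebra.lift_apply, FreeMonoid.lift_apply]

theorem word_mem_span (p : A N) : p ∈ Submodule.span ℚ (Set.range (word (N := N))) := by
  have h := (FreeAlgebra.basisFreeMonoid ℚ (Letter N)).mem_span p
  refine Submodule.span_mono ?_ h
  rintro _ ⟨w, rfl⟩
  exact ⟨FreeMonoid.toList w, (basisFreeMonoid_eq_word _).symm⟩

theorem linearIndependent_ofZWord : LinearIndependent ℚ (ofZWord (N := N)) := by
  have h := (FreeAlgebra.basisFreeMonoid ℚ (Letter N)).linearIndependent.comp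
    (fun w : ZWord N => FreeMonoid.ofList (letters w))
    (fun _ _ h => letters_injective (FreeMonoid.ofList.injective h))
  have e : (FreeAlgebra.basisFreeMonoid ℚ (Letter N)) ∘
      (fun w : ZWord N => FreeMonoid.ofList (letters w)) = ofZWord := by
    funext w
    simp only [Function.comp_apply]
    rw [basisFreeMonoid_eq_word, word_letters]
  rwa [e] at h

theorem span_ofZWord : Submodule.span ℚ (Set.range (ofZWord (N := N))) = A1 N := by
  apply le_antisymm
  · refine Submodule.span_le.2 ?_
    rintro _ ⟨w, rfl⟩
    rcases List.eq_nil_or_concat w with rfl | ⟨v, p, rfl⟩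
    · exact Submodule.subset_span (Or.inl rfl)
    · refine Submodule.subset_span (Or.inr ⟨ofZWord v * X ^ ((p.1 : ℕ) - 1), p.2, ?_⟩)
      simp [ofZWord, z, mul_assoc]
  · refine Submodule.span_le.2 ?_
    rintro p (hp | ⟨u, a, rfl⟩)
    · exact Submodule.subset_span ⟨[], hp.symm⟩
    · have hu := word_mem_span u
      induction hu using Submodule.span_induction with
      | mem q hq =>
        obtain ⟨v, rfl⟩ := hq
        obtain ⟨w, -, hw⟩ := exists_letters v a
        refine Submodule.subset_span ⟨w, ?_⟩
        rw [← word_letters, hw]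
        simp [word, Y]
      | zero => simp
      | add p q _ _ hp hq =>
        rw [add_mul]
        exact add_mem hp hq
      | smul c p _ hp =>
        rw [smul_mul_assoc]
        exact Submodule.smul_mem _ c hp

/-- The basis of `𝒜¹` consisting of the words `z_{k₁,a₁} ⋯ z_{kₙ,aₙ}`, `n ≥ 0`. -/
def zBasis : Module.Basis (ZWord N) ℚ (A1 N) :=
  (Module.Basis.span linearIndependent_ofZWord).map
    (LinearEquiv.ofEq _ _ span_ofZWord)

theorem coe_zBasis (w : ZWord N) : (zBasis w : A N) = ofZWord w := by
  simp [zBasis, Module.Basis.span_apply]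

/-! ### The map `ℐ` -/

/-- `[(k₁, a₁), (k₂, a₂), …] ↦ [(k₁, s + a₁), (k₂, s + a₁ + a₂), …]`. -/
def partialSums : ZMod N → ZWord N → ZWord N
  | _, [] => []
  | s, (k, a) :: w => (k, s + a) :: partialSums (s + a) w

/-- `[(k₁, a₁), (k₂, a₂), …] ↦ [(k₁, a₁ - s), (k₂, a₂ - a₁), …]`. -/
def differences : ZMod N → ZWord N → ZWord N
  | _, [] => []
  | s, (k, a) :: w => (k, a - s) :: differences a w

theorem differences_partialSums (s : ZMod N) (w : ZWord N) :
    differences s (partialSums s w) = w := by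
  induction w generalizing s with
  | nil => rfl
  | cons p w ih => simp [partialSums, differences, ih]

theorem partialSums_differences (s : ZMod N) (w : ZWord N) :
    partialSums s (differences s w) = w := by
  induction w generalizing s with
  | nil => rfl
  | cons p w ih => simp [partialSums, differences, ih]

/-- The bijection of words underlying `ℐ`. -/
def partialSumsEquiv : ZWord N ≃ ZWord N where
  toFun := partialSums 0
  invFun := differences 0
  left_inv := differences_partialSums 0
  right_inv := partialSums_differences 0

/-- The invertible `ℚ`-linear map `ℐ : 𝒜¹ → 𝒜¹`,
`z_{k₁,a₁} z_{k₂,a₂} ⋯ z_{kₙ,aₙ} ↦ z_{k₁,a₁} z_{k₂,a₁+a₂} ⋯ z_{kₙ,a₁+⋯+aₙ}`.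
Its inverse `ℐ⁻¹` is `calI.symm`. -/
def calI : A1 N ≃ₗ[ℚ] A1 N := zBasis.equiv zBasis partialSumsEquiv

/-! ### The harmonic shuffle product on `𝒜¹` -/

/-- Left multiplication by `z_{k,a}` on `𝒜¹`. -/
def consZ (k : ℕ+) (a : ZMod N) : A1 N →ₗ[ℚ] A1 N :=
  zBasis.constr ℚ fun w => zBasis ((k, a) :: w)

theorem coe_consZ (k : ℕ+) (a : ZMod N) (p : A1 N) :
    (consZ k a p : A N) = z (k : ℕ) a * (p : A N) := by
  have h : (A1 N).subtype ∘ₗ consZ k a =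
      LinearMap.mulLeft ℚ (z (k : ℕ) a) ∘ₗ (A1 N).subtype := by
    refine zBasis.ext fun w => ?_
    simp [consZ, coe_zBasis, ofZWord]
  exact LinearMap.congr_fun h p

/-- The harmonic shuffle product of two words in the `z_{k,a}`. -/
def harmonicWord : ZWord N → ZWord N → A1 N
  | [], w => zBasis w
  | p :: v, [] => zBasis (p :: v)
  | (k, a) :: v, (l, b) :: w =>
      consZ k a (harmonicWord v ((l, b) :: w)) + consZ l b (harmonicWord ((k, a) :: v) w) +
        consZ (k + l) (a + b) (harmonicWord v w)
termination_by v w => v.length + w.length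

/-- The harmonic shuffle product `∗` on `𝒜¹`. -/
def harmonicProd : A1 N →ₗ[ℚ] A1 N →ₗ[ℚ] A1 N :=
  zBasis.constr ℚ fun v => zBasis.constr ℚ fun w => harmonicWord v w

/-! ### The shuffle product -/

/-- The shuffle product of two words. -/
def shuffleWord : List (Letter N) → List (Letter N) → A N
  | [], w => word w
  | c :: v, [] => word (c :: v)
  | c :: v, d :: w =>
      FreeAlgebra.ι ℚ c * shuffleWord v (d :: w) + FreeAlgebra.ι ℚ d * shuffleWord (c :: v) w
termination_by v w => v.length + w.length

/-- The shuffle product on `𝒜`. -/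
def shuffle : A N →ₗ[ℚ] A N →ₗ[ℚ] A N :=
  (FreeAlgebra.basisFreeMonoid ℚ (Letter N)).constr ℚ fun v =>
    (FreeAlgebra.basisFreeMonoid ℚ (Letter N)).constr ℚ fun w =>
      shuffleWord (FreeMonoid.toList v) (FreeMonoid.toList w)

theorem shuffle_word (v w : List (Letter N)) :
    shuffle (word v) (word w) = shuffleWord v w := by
  rw [← basisFreeMonoid_eq_word v, ← basisFreeMonoid_eq_word w]
  simp [shuffle, Module.Basis.constr_basis]

/-- The words that are empty or end in some `y_a`. -/
def GoodEnd (w : List (Letter N)) : Prop := w = [] ∨ ∃ u a, w = u ++ [Letter.y a]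

theorem GoodEnd.tail {c : Letter N} {w : List (Letter N)} (h : GoodEnd (c :: w)) :
    GoodEnd w := by
  rcases h with h | ⟨u, a, h⟩
  · simp at h
  · cases u with
    | nil =>
      simp at h
      exact Or.inl h.2
    | cons d u =>
      simp at h
      exact Or.inr ⟨u, a, h.2⟩

theorem goodEnd_letters (w : ZWord N) : GoodEnd (letters w) := by
  induction w with
  | nil => exact Or.inl rfl
  | cons p w ih =>
    obtain ⟨k, a⟩ := p
    rcases ih with h | ⟨u, b, h⟩
    · exact Or.inr ⟨List.replicate ((k : ℕ) - 1) Letter.x, a, by simp [letters, h]⟩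
    · exact Or.inr ⟨List.replicate ((k : ℕ) - 1) Letter.x ++ Letter.y a :: u, b,
        by simp [letters, h]⟩

variable (N) in
/-- `∑_a 𝒜 y_a`. -/
def A1pos : Submodule ℚ (A N) := Submodule.span ℚ {p | ∃ (u : A N) (a : ZMod N), p = u * Y a}

theorem mul_mem_A1pos (q : A N) {p : A N} (hp : p ∈ A1pos N) : q * p ∈ A1pos N := by
  induction hp using Submodule.span_induction with
  | mem p hp =>
    obtain ⟨u, a, rfl⟩ := hp
    exact Submodule.subset_span ⟨q * u, a, by rw [mul_assoc]⟩
  | zero => simp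
  | add p p' _ _ hp hp' =>
    rw [mul_add]
    exact add_mem hp hp'
  | smul c p _ hp =>
    rw [mul_smul_comm]
    exact Submodule.smul_mem _ c hp

theorem word_mem_A1pos {w : List (Letter N)} (hw : GoodEnd w) (hne : w ≠ []) :
    word w ∈ A1pos N := by
  rcases hw with h | ⟨u, a, rfl⟩
  · exact absurd h hne
  · exact Submodule.subset_span ⟨word u, a, by simp [word, Y]⟩

theorem shuffleWord_mem_A1pos (v w : List (Letter N)) (hv : GoodEnd v) (hw : GoodEnd w)
    (hne : v ≠ [] ∨ w ≠ []) : shuffleWord v w ∈ A1pos N := by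
  induction v, w using shuffleWord.induct with
  | case1 w =>
    rw [shuffleWord]
    exact word_mem_A1pos hw (by simpa using hne)
  | case2 c v =>
    rw [shuffleWord]
    exact word_mem_A1pos hv (by simp)
  | case3 c v d w ih1 ih2 =>
    rw [shuffleWord]
    exact add_mem (mul_mem_A1pos _ (ih1 hv.tail hw (by simp)))
      (mul_mem_A1pos _ (ih2 hv hw.tail (by simp)))

theorem shuffle_mem_A1 {p q : A N} (hp : p ∈ A1 N) (hq : q ∈ A1 N) : shuffle p q ∈ A1 N := by
  rw [← span_ofZWord] at hp hq
  have hle : A1pos N ≤ A1 N := Submodule.span_mono Set.subset_union_right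
  induction hp using Submodule.span_induction with
  | mem p hp =>
    obtain ⟨v, rfl⟩ := hp
    induction hq using Submodule.span_induction with
    | mem q hq =>
      obtain ⟨w, rfl⟩ := hq
      rw [← word_letters, ← word_letters, shuffle_word]
      by_cases h : letters v ≠ [] ∨ letters w ≠ []
      · exact hle (shuffleWord_mem_A1pos _ _ (goodEnd_letters v) (goodEnd_letters w) h)
      · push Not at h
        rw [h.1, h.2, shuffleWord]
        exact Submodule.subset_span (Or.inl rfl)
    | zero => simp
    | add q q' _ _ hq hq' =>
      rw [map_add]
      exact add_mem hq hq'
    | smul c q _ hq =>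
      rw [map_smul]
      exact Submodule.smul_mem _ c hq
  | zero => simp
  | add p p' _ _ hp hp' =>
    rw [map_add, LinearMap.add_apply]
    exact add_mem hp hp'
  | smul c p _ hp =>
    rw [map_smul, LinearMap.smul_apply]
    exact Submodule.smul_mem _ c hp

/-- The shuffle product restricted to `𝒜¹`. -/
def shuffleA1 (p q : A1 N) : A1 N :=
  ⟨shuffle (p : A N) (q : A N), shuffle_mem_A1 p.2 q.2⟩

/-! ### Multiple `L`-values -/

variable (N) in
/-- `ω = exp(2πi/N)`. -/
def omega : ℂ := Complex.exp (2 * Real.pi * Complex.I / N)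

/-- The truncated series
`∑_{M > m₁ > ⋯ > mₙ > 0} ω^{a₁ m₁ + ⋯ + aₙ mₙ} / (m₁^{k₁} ⋯ mₙ^{kₙ})`, as a nested sum. -/
def LStarTrunc : ZWord N → ℕ → ℂ
  | [], _ => 1
  | (k, a) :: w, M =>
      ∑ m ∈ Finset.Ico 1 M, omega N ^ (a.val * m) / (m : ℂ) ^ (k : ℕ) * LStarTrunc w m

/-- The multiple `L`-value `L_∗(k₁, …, kₙ; a₁, …, aₙ)`: the sum of the (possibly only
conditionally convergent) series, that is, the limit of its truncations. The limit exists
if `k₁ ≥ 2` or `a₁ ≠ 0`. -/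
def LStarValue (w : ZWord N) : ℂ := Filter.limUnder Filter.atTop (LStarTrunc w)

/-- The evaluation map `ℒ_∗ : 𝒜⁰ → ℂ`, `z_{k₁,a₁} ⋯ z_{kₙ,aₙ} ↦ L_∗(k₁, …, kₙ; a₁, …, aₙ)`. -/
def LStar : A0 N →ₗ[ℚ] ℂ := zBasis.constr ℚ LStarValue ∘ₗ Submodule.inclusion A0_le_A1

/-! ### The words and index sets of the weighted sum formula

Indices are the usual ones: a family `k₁, …, kₙ` is a function `κ : ℕ → ℕ` that vanishes
outside of `{1, …, n}`, and for labels `c₁, c₂, …` only the values that occur matter. -/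

/-- The families `(κ_j)_{j ∈ s}` of positive integers with sum `k`. -/
def comps (s : Finset ℕ) (k : ℕ) : Finset (ℕ → ℕ) :=
  {κ ∈ s.piAntidiag k | ∀ j ∈ s, 1 ≤ κ j}

/-- The element `z_{κ₁,c₁} z_{κ₂,c₂} ⋯ z_{κₙ,cₙ}` of `𝒜`. -/
def zProd (n : ℕ) (κ : ℕ → ℕ) (c : ℕ → ZMod N) : A N :=
  ((List.range n).map fun j => z (κ (j + 1)) (c (j + 1))).prod

theorem zProd_mem_A1 (n : ℕ) (κ : ℕ → ℕ) (c : ℕ → ZMod N) : zProd n κ c ∈ A1 N := by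
  cases n with
  | zero => exact Submodule.subset_span (Or.inl (by simp [zProd]))
  | succ n =>
    refine Submodule.subset_span (Or.inr ⟨zProd n κ c * X ^ (κ (n + 1) - 1), c (n + 1), ?_⟩)
    simp [zProd, List.range_succ, z, mul_assoc]

/-- `z_{κ₁,c₁} z_{κ₂,c₂} ⋯ z_{κₙ,cₙ}` as an element of `𝒜¹`. -/
def zProd1 (n : ℕ) (κ : ℕ → ℕ) (c : ℕ → ZMod N) : A1 N := ⟨zProd n κ c, zProd_mem_A1 n κ c⟩

/-- `z_{l,a}` as an element of `𝒜¹`. -/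
def z1 (l : ℕ) (a : ZMod N) : A1 N :=
  ⟨z l a, Submodule.subset_span (Or.inr ⟨X ^ (l - 1), a, rfl⟩)⟩

/-- The labels `a₁, a₂ - a₁, a₃ - a₂, …`. -/
def diffLabel (α : ℕ → ZMod N) (j : ℕ) : ZMod N :=
  if j = 1 then α 1 else α j - α (j - 1)

/-- The labels `a, a₁ - a, a₂ - a₁, a₃ - a₂, …`. -/
def frontDiffLabel (a : ZMod N) (α : ℕ → ZMod N) (j : ℕ) : ZMod N :=
  if j = 1 then a else if j = 2 then α 1 - a else diffLabel α (j - 1)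

/-- The labels `a₁, a₂ - a₁, …, a_{i-1} - a_{i-2}, a - a_{i-1}, a_i - a, a_{i+1} - a_i, …`,
for `i ≥ 2`. -/
def midDiffLabel (a : ZMod N) (α : ℕ → ZMod N) (i j : ℕ) : ZMod N :=
  if j < i then diffLabel α j
  else if j = i then a - α (i - 1)
  else if j = i + 1 then α i - a
  else diffLabel α (j - 1)

/-- The labels `a₁, a₂ - a₁, …, a_{n-1} - a_{n-2}, a - a_{n-1}`. -/
def backDiffLabel (a : ZMod N) (α : ℕ → ZMod N) (n j : ℕ) : ZMod N :=
  if j < n then diffLabel α j else a - α (n - 1)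

/-- The labels `a₁, a₂ - a₁, …, a_i - a_{i-1}, a, a_{i+1} - a_i, …`; for `i = 0` these are
`a, a₁, a₂ - a₁, …`. -/
def insertLabel (a : ZMod N) (α : ℕ → ZMod N) (i j : ℕ) : ZMod N :=
  if j ≤ i then diffLabel α j else if j = i + 1 then a else diffLabel α (j - 1)

/-- The labels `a₁, …, a_{i-1} - a_{i-2}, a + a_i - a_{i-1}, a_{i+1} - a_i, …`; for `i = 1`
these are `a + a₁, a₂ - a₁, …`. -/
def addLabel (a : ZMod N) (α : ℕ → ZMod N) (i j : ℕ) : ZMod N :=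
  if j = i then a + diffLabel α i else diffLabel α j

/-- The explicit combination of words in the weighted sum formula of weight `k` and depth `n`,
for `a` and `a₁ = α 1, …, a_{n-1} = α (n - 1)`. -/
def weightedSum (n k : ℕ) (a : ZMod N) (α : ℕ → ZMod N) : A N :=
  (∑ κ ∈ comps (Finset.Icc 1 n) k with 2 ≤ κ 2,
      (2 : ℚ) ^ (κ 1 - 1) • zProd n κ (frontDiffLabel a α))
  + (∑ κ ∈ comps (Finset.Icc 1 n) k with 2 ≤ κ 1 ∧ κ 2 = 1,
      ((2 : ℚ) ^ (κ 1 - 1) - 1) • zProd n κ (frontDiffLabel a α))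
  + (∑ i ∈ Finset.Icc 2 (n - 1), ∑ κ ∈ comps (Finset.Icc 1 n) k with 2 ≤ κ 1,
      ((2 : ℚ) ^ ((∑ j ∈ Finset.Icc 1 i, κ j) - i) -
        (2 : ℚ) ^ ((∑ j ∈ Finset.Icc 2 i, κ j) - (i - 1))) • zProd n κ (midDiffLabel a α i))
  + (∑ κ ∈ comps (Finset.Icc 1 n) k with 2 ≤ κ 1,
      ((2 : ℚ) ^ ((∑ j ∈ Finset.Icc 1 (n - 1), κ j) - (n - 1)) -
        (2 : ℚ) ^ ((∑ j ∈ Finset.Icc 2 (n - 1), κ j) - (n - 2))) •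
          zProd n κ (backDiffLabel a α n))
  - (∑ κ ∈ comps (Finset.Icc 1 n) k with 2 ≤ κ 2, zProd n κ (insertLabel a α 0))
  - (∑ i ∈ Finset.Icc 1 (n - 1), ∑ κ ∈ comps (Finset.Icc 1 n) k with 2 ≤ κ 1,
      zProd n κ (insertLabel a α i))
  - (∑ κ ∈ comps (Finset.Icc 1 (n - 1)) k with 2 ≤ κ 1,
      ((κ 1 : ℚ) - 2) • zProd (n - 1) κ (addLabel a α 1))
  - (∑ i ∈ Finset.Icc 2 (n - 1), ∑ κ ∈ comps (Finset.Icc 1 (n - 1)) k with 2 ≤ κ 1,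
      ((κ i : ℚ) - 1) • zProd (n - 1) κ (addLabel a α i))

end MultipleL

end

open MultipleL

noncomputable section

namespace MultipleL

open PowerSeries (coeff C mk)
open Finset.HasAntidiagonal (antidiagonal)

variable {N : ℕ}

/-! The proof has an algebraic half (the identity) and an analytic half (the kernel statement).

Algebra. With a central variable `t`, put Z_b = ∑_{k≥1} z_{k,b} t^k, Q_b = ∑_{k≥1} 2^{k-1} z_{k,b}
t^k and G_b = ∑_{k≥2} z_{k,b} t^k. A sum over compositions of k whose coefficient is a product of
functions of the single parts is the coefficient of t^k in a product of such series
(`coeff_zSeriesProd`), so both products only have to be computed on series. Since Z_b = y_b t + x t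
Z_b and Q_b = y_b t + 2 x t Q_b, the letterwise shuffle recursion turns into linear equations whose
solutions are Z_a ш Z_b V = Q_a Z_b V + Q_b (Z_a ш V) and Z_a ш G_b V = (Q_a - Z_a) Z_b V + (Q_b -
Z_b)(Z_a ш V) + Z_a G_b V (`shuffleSeries_zSeries_mul`, `shuffleSeries_zSeries_wGeTwo_mul`).
Iterating them produces all powers of 2. The harmonic product is treated in the same way
(`harmonicSeries_zSeries_mul`); its merged letters z_{k+l,a+b} give the factors k_1 - 2 and k_i - 1,
which count the ways of splitting an exponent. Finally ℐ⁻¹ replaces labels by their successive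
differences.

Analysis. Each summand on the left is a double shuffle relation, and z_{l,a} may be the divergent
z_{1,0}, so one works with truncations. Truncated nested sums are exactly multiplicative for ∗
(`truncMap_harmonicProd`). Multiple polylogarithms, as formal power series, are multiplicative for
ш, because t d/dt is a derivation (`polylog_shuffleWord`); the M-th truncation of ℐ⁻¹(p) is the sum
of the first M coefficients of the polylogarithm of p (`truncMap_calI_symm`). Hence the truncated
relation is a partial sum of a Cauchy product minus the product of the partial sums. This tends to 0
when one factor has coefficients bounded by 1/i and the other is summable against 1 + log j, which
k_1 ≥ 2 guarantees (`tendsto_sum_cauchyProduct_sub`). On 𝒜⁰ the truncations also converge to ℒ_∗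
(`tendsto_truncMap_LStar`), so uniqueness of limits gives the kernel statement. -/

/-! ### Generating series of words -/

/-- The generating series `∑_k g(k) z_{k,b} t^k`. -/
def zSeries (g : ℕ → ℚ) (b : ZMod N) : PowerSeries (A N) := mk fun k => g k • z k b

/-- The product of the generating series of weights `w₁, …, wₙ` and labels `c₁, …, cₙ`. -/
def zSeriesProd (n : ℕ) (w : ℕ → ℕ → ℚ) (c : ℕ → ZMod N) : PowerSeries (A N) :=
  ((List.range n).map fun j => zSeries (w (j + 1)) (c (j + 1))).prod

/-- The weight `1` on positive integers. -/
def wOne (k : ℕ) : ℚ := if k = 0 then 0 else 1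

/-- The weight `2^{k-1}` on positive integers. -/
def wTwo (k : ℕ) : ℚ := if k = 0 then 0 else 2 ^ (k - 1)

/-- The indicator of `k ≥ 2`. -/
def wGeTwo (k : ℕ) : ℚ := if 2 ≤ k then 1 else 0

/-- The indicator of `k = 1`. -/
def wEqOne (k : ℕ) : ℚ := if k = 1 then 1 else 0

theorem wOne_eq : wOne = wGeTwo + wEqOne := by
  funext k
  simp only [wOne, wGeTwo, wEqOne, Pi.add_apply]
  split_ifs <;> first | omega | norm_num

theorem zSeries_add (g h : ℕ → ℚ) (b : ZMod N) :
    zSeries (g + h) b = zSeries g b + zSeries h b := by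
  ext k
  simp [zSeries, add_smul]

theorem zSeries_sub (g h : ℕ → ℚ) (b : ZMod N) :
    zSeries (g - h) b = zSeries g b - zSeries h b := by
  ext k
  simp [zSeries, sub_smul]

theorem zSeriesProd_zero (w : ℕ → ℕ → ℚ) (c : ℕ → ZMod N) : zSeriesProd 0 w c = 1 := by
  simp [zSeriesProd]

theorem zSeriesProd_succ (n : ℕ) (w : ℕ → ℕ → ℚ) (c : ℕ → ZMod N) :
    zSeriesProd (n + 1) w c =
      zSeries (w 1) (c 1) * zSeriesProd n (fun j => w (j + 1)) (fun j => c (j + 1)) := by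
  simp [zSeriesProd, List.range_succ_eq_map, List.map_map, Function.comp_def]

theorem zSeriesProd_congr {n : ℕ} {w w' : ℕ → ℕ → ℚ} {c c' : ℕ → ZMod N}
    (hw : ∀ j, 1 ≤ j → j ≤ n → w j = w' j) (hc : ∀ j, 1 ≤ j → j ≤ n → c j = c' j) :
    zSeriesProd n w c = zSeriesProd n w' c' := by
  unfold zSeriesProd
  congr 1
  refine List.map_congr_left fun j hj => ?_
  rw [List.mem_range] at hj
  rw [hw _ (by omega) (by omega), hc _ (by omega) (by omega)]

theorem zProd_congr {n : ℕ} {κ κ' : ℕ → ℕ} {c c' : ℕ → ZMod N}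
    (hκ : ∀ j, 1 ≤ j → j ≤ n → κ j = κ' j) (hc : ∀ j, 1 ≤ j → j ≤ n → c j = c' j) :
    zProd n κ c = zProd n κ' c' := by
  unfold zProd
  congr 1
  refine List.map_congr_left fun j hj => ?_
  rw [List.mem_range] at hj
  rw [hκ _ (by omega) (by omega), hc _ (by omega) (by omega)]

theorem zProd_succ (n : ℕ) (κ : ℕ → ℕ) (c : ℕ → ZMod N) :
    zProd (n + 1) κ c =
      z (κ 1) (c 1) * zProd n (fun j => κ (j + 1)) (fun j => c (j + 1)) := by
  simp [zProd, List.range_succ_eq_map, List.map_map, Function.comp_def]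

/-- Splits off the part at `i`. A family supported on `s` vanishes at `i`, so adding a value there
is the same as overwriting. -/
theorem sum_piAntidiag_cons {M : Type*} [AddCommMonoid M] {s : Finset ℕ} {i : ℕ} (hi : i ∉ s)
    (k : ℕ) (f : (ℕ → ℕ) → M) :
    ∑ κ ∈ (Finset.cons i s hi).piAntidiag k, f κ =
      ∑ p ∈ antidiagonal k, ∑ κ ∈ s.piAntidiag p.2, f (Function.update κ i p.1) := by
  rw [Finset.piAntidiag_cons hi, Finset.sum_disjiUnion]
  refine Finset.sum_congr rfl fun p _ => ?_
  rw [Finset.sum_map]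
  refine Finset.sum_congr rfl fun κ hκ => ?_
  congr 1
  have h0 : κ i = 0 := by
    by_contra h
    exact hi ((Finset.mem_piAntidiag.1 hκ).2 i h)
  funext j
  by_cases hj : j = i
  · subst hj
    simp [h0]
  · simp [hj]

/-- The dictionary between sums over compositions and products of series. The induction removes the
last factor, so that the remaining indices are not shifted. -/
theorem coeff_zSeriesProd (n k : ℕ) (w : ℕ → ℕ → ℚ) (c : ℕ → ZMod N) :
    coeff k (zSeriesProd n w c) =
      ∑ κ ∈ (Finset.Icc 1 n).piAntidiag k, (∏ j ∈ Finset.Icc 1 n, w j (κ j)) • zProd n κ c := by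
  induction n generalizing k with
  | zero =>
    rw [zSeriesProd_zero, PowerSeries.coeff_one]
    have : Finset.Icc 1 0 = (∅ : Finset ℕ) := by simp
    rw [this, Finset.piAntidiag_empty]
    split_ifs <;> simp [zProd]
  | succ n ih =>
    have hs : zSeriesProd (n + 1) w c = zSeriesProd n w c * zSeries (w (n + 1)) (c (n + 1)) := by
      simp [zSeriesProd, List.range_succ]
    have hI : Finset.Icc 1 (n + 1) = Finset.cons (n + 1) (Finset.Icc 1 n) (by simp) := by
      ext j
      simp only [Finset.mem_Icc, Finset.mem_cons]
      omega
    rw [hs, PowerSeries.coeff_mul, hI, sum_piAntidiag_cons,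
      ← Finset.Nat.sum_antidiagonal_swap]
    refine Finset.sum_congr rfl fun p _ => ?_
    simp only [Prod.fst_swap, Prod.snd_swap]
    rw [ih, Finset.sum_mul]
    refine Finset.sum_congr rfl fun κ _ => ?_
    have hz : zProd (n + 1) (Function.update κ (n + 1) p.1) c =
        zProd n κ c * z p.1 (c (n + 1)) := by
      rw [← zProd_congr (κ := Function.update κ (n + 1) p.1) (κ' := κ) (c := c) (c' := c)
        (n := n) (fun j _ hj => Function.update_of_ne (by omega) _ _) (fun _ _ _ => rfl)]
      simp [zProd, List.range_succ]
    have hw : ∏ j ∈ Finset.Icc 1 n, w j (Function.update κ (n + 1) p.1 j) =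
        ∏ j ∈ Finset.Icc 1 n, w j (κ j) := by
      refine Finset.prod_congr rfl fun j hj => ?_
      rw [Finset.mem_Icc] at hj
      rw [Function.update_of_ne (by omega)]
    rw [hz, Finset.prod_cons, hw, zSeries, PowerSeries.coeff_mk, Function.update_self,
      smul_mul_smul_comm, mul_comm]

theorem coeff_zSeriesProd_mem_A1 (n k : ℕ) (w : ℕ → ℕ → ℚ) (c : ℕ → ZMod N) :
    coeff k (zSeriesProd n w c) ∈ A1 N := by
  rw [coeff_zSeriesProd]
  exact sum_mem fun κ _ => Submodule.smul_mem _ _ (zProd_mem_A1 n κ c)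

theorem mem_comps {s : Finset ℕ} {k : ℕ} {κ : ℕ → ℕ} :
    κ ∈ comps s k ↔ κ ∈ s.piAntidiag k ∧ ∀ j ∈ s, 1 ≤ κ j := by
  simp [comps]

/-- The form in which sums of the formula are read as coefficients: weights vanishing at 0 encode
the positivity of the parts, and the side condition `P` is absorbed into the factorised coefficient.
-/
theorem sum_comps_smul_zProd {n k : ℕ} {P : (ℕ → ℕ) → Prop} [DecidablePred P]
    {f : (ℕ → ℕ) → ℚ} {w : ℕ → ℕ → ℚ} (c : ℕ → ZMod N)
    (hw : ∀ j ∈ Finset.Icc 1 n, w j 0 = 0)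
    (h : ∀ κ : ℕ → ℕ, (∀ j ∈ Finset.Icc 1 n, 1 ≤ κ j) →
      (if P κ then f κ else 0) = ∏ j ∈ Finset.Icc 1 n, w j (κ j)) :
    ∑ κ ∈ comps (Finset.Icc 1 n) k with P κ, f κ • zProd n κ c =
      coeff k (zSeriesProd n w c) := by
  rw [coeff_zSeriesProd, Finset.sum_filter, comps, Finset.sum_filter]
  refine Finset.sum_congr rfl fun κ _ => ?_
  split_ifs with h1 h2
  · rw [← h κ h1, if_pos h2]
  · rw [← h κ h1, if_neg h2, zero_smul]
  · push Not at h1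
    obtain ⟨j, hj, hj'⟩ := h1
    rw [Finset.prod_eq_zero hj, zero_smul]
    rw [show κ j = 0 by omega, hw j hj]

/-! ### Bilinear maps on generating series -/

/-- The coefficientwise extension of a bilinear map to power series. -/
def bilSeries (B : A N →ₗ[ℚ] A N →ₗ[ℚ] A N) (F G : PowerSeries (A N)) : PowerSeries (A N) :=
  mk fun k => ∑ p ∈ antidiagonal k, B (coeff p.1 F) (coeff p.2 G)

theorem bilSeries_add_left (B : A N →ₗ[ℚ] A N →ₗ[ℚ] A N) (F F' G : PowerSeries (A N)) :
    bilSeries B (F + F') G = bilSeries B F G + bilSeries B F' G := by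
  ext k
  simp [bilSeries, Finset.sum_add_distrib]

theorem bilSeries_add_right (B : A N →ₗ[ℚ] A N →ₗ[ℚ] A N) (F G G' : PowerSeries (A N)) :
    bilSeries B F (G + G') = bilSeries B F G + bilSeries B F G' := by
  ext k
  simp [bilSeries, Finset.sum_add_distrib]

theorem bilSeries_X_mul_left (B : A N →ₗ[ℚ] A N →ₗ[ℚ] A N) (F G : PowerSeries (A N)) :
    bilSeries B (PowerSeries.X * F) G = PowerSeries.X * bilSeries B F G := by
  ext k
  cases k with
  | zero => simp [bilSeries]
  | succ k =>
    rw [PowerSeries.coeff_succ_X_mul]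
    simp only [bilSeries, PowerSeries.coeff_mk]
    rw [Finset.Nat.antidiagonal_succ]
    simp [PowerSeries.coeff_succ_X_mul]

theorem bilSeries_X_mul_right (B : A N →ₗ[ℚ] A N →ₗ[ℚ] A N) (F G : PowerSeries (A N)) :
    bilSeries B F (PowerSeries.X * G) = PowerSeries.X * bilSeries B F G := by
  ext k
  cases k with
  | zero => simp [bilSeries]
  | succ k =>
    rw [PowerSeries.coeff_succ_X_mul]
    simp only [bilSeries, PowerSeries.coeff_mk]
    rw [Finset.Nat.antidiagonal_succ']
    simp [PowerSeries.coeff_succ_X_mul]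

/-- Stated for an arbitrary bilinear `B` because it serves both the shuffle and the harmonic
product. The part at index 0 is the exponent l of the single letter. -/
theorem sum_comps_bilinear (B : A N →ₗ[ℚ] A N →ₗ[ℚ] A N) (m k : ℕ) (a : ZMod N)
    (c : ℕ → ZMod N) :
    ∑ κ ∈ comps (Finset.Icc 0 (m + 1)) k with 2 ≤ κ 1, B (z (κ 0) a) (zProd (m + 1) κ c) =
      coeff k (bilSeries B (zSeries wOne a)
        (zSeries wGeTwo (c 1) * zSeriesProd m (fun _ => wOne) fun j => c (j + 1))) := by
  have hI : Finset.Icc 0 (m + 1) = Finset.cons 0 (Finset.Icc 1 (m + 1)) (by simp) := by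
    ext j
    simp only [Finset.mem_Icc, Finset.mem_cons]
    omega
  have hV : zSeries wGeTwo (c 1) * zSeriesProd m (fun _ => wOne) (fun j => c (j + 1)) =
      zSeriesProd (m + 1) (fun j => if j = 1 then wGeTwo else wOne) c := by
    rw [zSeriesProd_succ]
    simp only [if_true]
    congr 1
  rw [hV, Finset.sum_filter, comps, Finset.sum_filter, hI, sum_piAntidiag_cons]
  simp only [bilSeries, PowerSeries.coeff_mk]
  refine Finset.sum_congr rfl fun p _ => ?_
  rw [zSeries, PowerSeries.coeff_mk, coeff_zSeriesProd, map_sum]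
  refine Finset.sum_congr rfl fun κ _ => ?_
  have h1 : zProd (m + 1) (Function.update κ 0 p.1) c = zProd (m + 1) κ c :=
    zProd_congr (fun j hj _ => Function.update_of_ne (by omega) _ _) fun _ _ _ => rfl
  have h2 : Function.update κ 0 p.1 1 = κ 1 := Function.update_of_ne (by omega) _ _
  have h3 : (∀ j ∈ Finset.cons 0 (Finset.Icc 1 (m + 1)) (by simp),
      1 ≤ Function.update κ 0 p.1 j) ↔ 1 ≤ p.1 ∧ ∀ j ∈ Finset.Icc 1 (m + 1), 1 ≤ κ j := by
    rw [Finset.forall_mem_cons, Function.update_self]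
    refine and_congr_right fun _ => forall₂_congr fun j hj => ?_
    rw [Finset.mem_Icc] at hj
    rw [Function.update_of_ne (by omega)]
  rw [h1, h2, Function.update_self, map_smul, map_smul, LinearMap.smul_apply, smul_smul]
  simp only [h3]
  split_ifs with h4 h5
  · have e1 : wOne p.1 = 1 := by simp [wOne]; omega
    rw [e1, mul_one, Finset.prod_eq_one, one_smul]
    intro j hj
    have := h4.2 j hj
    split_ifs with h6
    · subst h6
      simp [wGeTwo, h5]
    · simp [wOne]
      omega
  · rw [Finset.prod_eq_zero (i := 1) (by simp), zero_mul, zero_smul]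
    simp [wGeTwo, h5]
  · by_cases hp : 1 ≤ p.1
    · have : ∃ j ∈ Finset.Icc 1 (m + 1), κ j = 0 := by
        by_contra hcon
        push Not at hcon
        exact h4 ⟨hp, fun j hj => Nat.one_le_iff_ne_zero.2 (hcon j hj)⟩
      obtain ⟨j, hj, hj'⟩ := this
      rw [Finset.prod_eq_zero hj, zero_mul, zero_smul]
      rw [hj']
      split_ifs <;> simp [wGeTwo, wOne]
    · have : p.1 = 0 := by omega
      rw [this]
      simp [wOne]

/-! ### The shuffle product on generating series -/

theorem word_cons (c : Letter N) (w : List (Letter N)) :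
    word (c :: w) = FreeAlgebra.ι ℚ c * word w := by
  simp [word]

theorem word_nil : word ([] : List (Letter N)) = 1 := rfl

theorem shuffle_one_left (q : A N) : shuffle 1 q = q := by
  have hq := word_mem_span q
  induction hq using Submodule.span_induction with
  | mem q hq =>
    obtain ⟨w, rfl⟩ := hq
    rw [← word_nil, shuffle_word, shuffleWord]
  | zero => simp
  | add p q _ _ hp hq => rw [map_add, hp, hq]
  | smul c p _ hp => rw [map_smul, hp]

theorem shuffle_one_right (p : A N) : shuffle p 1 = p := by
  have hp := word_mem_span p
  induction hp using Submodule.span_induction with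
  | mem p hp =>
    obtain ⟨w, rfl⟩ := hp
    rw [← word_nil, shuffle_word]
    cases w <;> rw [shuffleWord]
  | zero => simp
  | add p q _ _ hp hq => rw [map_add, LinearMap.add_apply, hp, hq]
  | smul c p _ hp => rw [map_smul, LinearMap.smul_apply, hp]

theorem shuffle_ι_mul (c d : Letter N) (p q : A N) :
    shuffle (FreeAlgebra.ι ℚ c * p) (FreeAlgebra.ι ℚ d * q) =
      FreeAlgebra.ι ℚ c * shuffle p (FreeAlgebra.ι ℚ d * q) +
        FreeAlgebra.ι ℚ d * shuffle (FreeAlgebra.ι ℚ c * p) q := by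
  have hp := word_mem_span p
  have hq := word_mem_span q
  induction hp using Submodule.span_induction with
  | mem p hp =>
    obtain ⟨v, rfl⟩ := hp
    induction hq using Submodule.span_induction with
    | mem q hq =>
      obtain ⟨w, rfl⟩ := hq
      rw [← word_cons, ← word_cons, shuffle_word, shuffle_word, shuffle_word, shuffleWord]
    | zero => simp
    | add q q' _ _ hq hq' =>
      simp only [mul_add, map_add] at hq hq' ⊢
      rw [hq, hq']
      abel
    | smul r q _ hq =>
      simp only [mul_smul_comm, map_smul] at hq ⊢
      rw [hq, smul_add]
  | zero => simp
  | add p p' _ _ hp hp' =>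
    simp only [mul_add, map_add, LinearMap.add_apply] at hp hp' ⊢
    rw [hp, hp']
    abel
  | smul r p _ hp =>
    simp only [mul_smul_comm, map_smul, LinearMap.smul_apply] at hp ⊢
    rw [hp, smul_add]

/-- The power series `c t` for a letter `c`. -/
def letterSeries (c : Letter N) : PowerSeries (A N) := PowerSeries.X * C (FreeAlgebra.ι ℚ c)

/-- The shuffle product of power series. -/
abbrev shuffleSeries (F G : PowerSeries (A N)) : PowerSeries (A N) := bilSeries shuffle F G

theorem shuffleSeries_one_left (G : PowerSeries (A N)) : shuffleSeries 1 G = G := by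
  ext k
  simp only [shuffleSeries, bilSeries, PowerSeries.coeff_mk]
  rw [Finset.sum_eq_single (0, k)]
  · simp [shuffle_one_left]
  · rintro ⟨i, j⟩ hij hne
    have : i ≠ 0 := by
      rintro rfl
      simp at hij
      simp [hij] at hne
    simp [PowerSeries.coeff_one, this]
  · simp

theorem shuffleSeries_one_right (F : PowerSeries (A N)) : shuffleSeries F 1 = F := by
  ext k
  simp only [shuffleSeries, bilSeries, PowerSeries.coeff_mk]
  rw [Finset.sum_eq_single (k, 0)]
  · simp [shuffle_one_right]
  · rintro ⟨i, j⟩ hij hne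
    have : j ≠ 0 := by
      rintro rfl
      simp at hij
      simp [hij] at hne
    simp [PowerSeries.coeff_one, this]
  · simp

/-- The recursion for words holds coefficientwise for series by bilinearity; the powers of the
central variable are then pulled out. -/
theorem shuffleSeries_letter_mul (c d : Letter N) (F G : PowerSeries (A N)) :
    shuffleSeries (letterSeries c * F) (letterSeries d * G) =
      letterSeries c * shuffleSeries F (letterSeries d * G) +
        letterSeries d * shuffleSeries (letterSeries c * F) G := by
  have h : shuffleSeries (C (FreeAlgebra.ι ℚ c) * F) (C (FreeAlgebra.ι ℚ d) * G) =
      C (FreeAlgebra.ι ℚ c) * shuffleSeries F (C (FreeAlgebra.ι ℚ d) * G) +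
        C (FreeAlgebra.ι ℚ d) * shuffleSeries (C (FreeAlgebra.ι ℚ c) * F) G := by
    ext k
    simp only [shuffleSeries, bilSeries, PowerSeries.coeff_mk, map_add, PowerSeries.coeff_C_mul,
      shuffle_ι_mul, Finset.sum_add_distrib, Finset.mul_sum]
  have hX : ∀ (r : A N) (F : PowerSeries (A N)),
      C r * (PowerSeries.X * F) = PowerSeries.X * (C r * F) := fun r F => by
    rw [← mul_assoc, (PowerSeries.commute_X (C r)).eq, mul_assoc]
  simp only [letterSeries, mul_assoc, shuffleSeries, bilSeries_X_mul_left, bilSeries_X_mul_right,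
    hX] at h ⊢
  rw [h, mul_add, mul_add]

theorem z_one (b : ZMod N) : z 1 b = Y b := by simp [z]

theorem z_succ {k : ℕ} (hk : k ≠ 0) (b : ZMod N) : z (k + 1) b = X * z k b := by
  obtain ⟨j, rfl⟩ := Nat.exists_eq_succ_of_ne_zero hk
  simp [z, pow_succ', mul_assoc]

/-- A geometric weight gives a geometric generating series. -/
theorem zSeries_geometric (r : ℚ) (g : ℕ → ℚ) (h0 : g 0 = 0) (h1 : g 1 = 1)
    (hg : ∀ k, k ≠ 0 → g (k + 1) = r * g k) (b : ZMod N) :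
    zSeries g b = letterSeries (Letter.y b) + r • (letterSeries Letter.x * zSeries g b) := by
  ext k
  rw [map_add, PowerSeries.coeff_smul, letterSeries, letterSeries, mul_assoc]
  rcases k with _ | _ | k
  · simp [zSeries, h0]
  · rw [PowerSeries.coeff_succ_X_mul, PowerSeries.coeff_succ_X_mul]
    simp [zSeries, h1, h0, z_one, Y]
  · rw [PowerSeries.coeff_succ_X_mul, PowerSeries.coeff_succ_X_mul, PowerSeries.coeff_C_mul]
    simp only [zSeries, PowerSeries.coeff_mk, PowerSeries.coeff_C]
    rw [hg _ (by omega), z_succ (by omega)]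
    simp [X, mul_smul]

theorem zSeries_wOne (b : ZMod N) :
    zSeries wOne b = letterSeries (Letter.y b) + letterSeries Letter.x * zSeries wOne b := by
  conv_lhs => rw [zSeries_geometric 1 wOne (by simp [wOne]) (by simp [wOne])
    (fun k hk => by simp [wOne, hk]) b]
  rw [one_smul]

theorem zSeries_wTwo (b : ZMod N) :
    zSeries wTwo b = letterSeries (Letter.y b) + letterSeries Letter.x * zSeries wTwo b +
      letterSeries Letter.x * zSeries wTwo b := by
  conv_lhs => rw [zSeries_geometric 2 wTwo (by simp [wTwo]) (by simp [wTwo])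
    (fun k hk => by
      obtain ⟨j, rfl⟩ := Nat.exists_eq_succ_of_ne_zero hk
      simp [wTwo, pow_succ']) b]
  rw [two_smul, add_assoc]

theorem zSeries_wGeTwo (b : ZMod N) :
    zSeries wGeTwo b = letterSeries Letter.x * zSeries wOne b := by
  ext k
  rw [letterSeries, mul_assoc]
  rcases k with _ | _ | k
  · simp [zSeries, wGeTwo]
  · rw [PowerSeries.coeff_succ_X_mul]
    simp [zSeries, wGeTwo, wOne]
  · rw [PowerSeries.coeff_succ_X_mul, PowerSeries.coeff_C_mul]
    simp only [zSeries, PowerSeries.coeff_mk]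
    rw [z_succ (by omega)]
    simp [X, wGeTwo, wOne]

/-- A fixed point of multiplication by a scalar multiple of `c t` vanishes. -/
theorem eq_zero_of_eq_letterSeries_mul {c : Letter N} {r : ℚ} {F : PowerSeries (A N)}
    (h : F = r • (letterSeries c * F)) : F = 0 := by
  ext k
  induction k with
  | zero =>
    rw [h, letterSeries, mul_assoc, PowerSeries.coeff_smul]
    simp
  | succ k ih =>
    rw [h, letterSeries, mul_assoc, PowerSeries.coeff_smul, PowerSeries.coeff_succ_X_mul,
      PowerSeries.coeff_C_mul, ih]
    simp

/-- With W = Z_b V, both sides solve F = y_a t W + y_b t (Z_a ш V) + 2 x t F, and the difference of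
two solutions is fixed by multiplication by 2 x t, hence is zero. -/
theorem shuffleSeries_zSeries_mul (a b : ZMod N) (V : PowerSeries (A N)) :
    shuffleSeries (zSeries wOne a) (zSeries wOne b * V) =
      zSeries wTwo a * (zSeries wOne b * V) +
        zSeries wTwo b * shuffleSeries (zSeries wOne a) V := by
  set x : PowerSeries (A N) := letterSeries Letter.x with hx
  set ya : PowerSeries (A N) := letterSeries (Letter.y a) with hya
  set yb : PowerSeries (A N) := letterSeries (Letter.y b) with hyb
  set Z := zSeries wOne a with hZ
  set W := zSeries wOne b * V with hW
  have eZ : Z = ya * 1 + x * Z := by rw [mul_one]; exact zSeries_wOne a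
  have eW : W = yb * V + x * W := by
    rw [hW]
    conv_lhs => rw [zSeries_wOne b]
    rw [add_mul, mul_assoc]
  -- Both factors can start with x, so x t (Z ш W) occurs twice; this is the origin of the powers of
  -- 2.
  have e : shuffleSeries Z W = ya * W + yb * shuffleSeries Z V + x * shuffleSeries Z W +
      x * shuffleSeries Z W := by
    calc shuffleSeries Z W = shuffleSeries (ya * 1 + x * Z) (yb * V + x * W) := by
          rw [← eZ, ← eW]
      _ = ya * shuffleSeries 1 (yb * V + x * W) + yb * shuffleSeries (ya * 1 + x * Z) V +
            x * shuffleSeries Z (yb * V + x * W) + x * shuffleSeries (ya * 1 + x * Z) W := by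
          simp only [shuffleSeries, bilSeries_add_left, bilSeries_add_right, mul_add]
          simp only [hx, hya, hyb]
          have h := @shuffleSeries_letter_mul N
          simp only [shuffleSeries] at h
          simp only [h]
          abel
      _ = _ := by rw [← eZ, ← eW, shuffleSeries_one_left]
  rw [← sub_eq_zero]
  refine eq_zero_of_eq_letterSeries_mul (c := Letter.x) (r := 2) ?_
  rw [← hx, two_smul]
  conv_lhs => rw [e, zSeries_wTwo a, zSeries_wTwo b]
  rw [← hx, ← hya, ← hyb]
  noncomm_ring

/-- Here G_b V = x t W with W = Z_b V. The second factor can only start with x, so the equation for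
T = Z_a ш x t W reads (1 - x t) T = y_a t x t W + x t (Z_a ш W), and Z_a ш W is known from the
previous lemma. -/
theorem shuffleSeries_zSeries_wGeTwo_mul (a b : ZMod N) (V : PowerSeries (A N)) :
    shuffleSeries (zSeries wOne a) (zSeries wGeTwo b * V) =
      zSeries (wTwo - wOne) a * (zSeries wOne b * V) +
        zSeries (wTwo - wOne) b * shuffleSeries (zSeries wOne a) V +
        zSeries wOne a * (zSeries wGeTwo b * V) := by
  have eG := zSeries_wGeTwo b
  have eS := shuffleSeries_zSeries_mul a b V
  have eZa := zSeries_wOne a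
  have eZb := zSeries_wOne b
  have eQa := zSeries_wTwo a
  have eQb := zSeries_wTwo b
  rw [zSeries_sub, zSeries_sub]
  set x : PowerSeries (A N) := letterSeries Letter.x with hx
  set ya : PowerSeries (A N) := letterSeries (Letter.y a) with hya
  set Z := zSeries wOne a with hZ
  set W := zSeries wOne b * V with hW
  have eGV : zSeries wGeTwo b * V = x * W := by rw [eG, mul_assoc]
  rw [eGV]
  have e : shuffleSeries Z (x * W) = ya * (x * W) + x * shuffleSeries Z (x * W) +
      x * shuffleSeries Z W := by
    calc shuffleSeries Z (x * W) = shuffleSeries (ya * 1 + x * Z) (x * W) := by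
          rw [mul_one, ← eZa]
      _ = ya * shuffleSeries 1 (x * W) + x * shuffleSeries Z (x * W) +
            x * shuffleSeries (ya * 1 + x * Z) W := by
          simp only [shuffleSeries, bilSeries_add_left, mul_add]
          simp only [hx, hya]
          have h := @shuffleSeries_letter_mul N
          simp only [shuffleSeries] at h
          simp only [h]
          abel
      _ = _ := by rw [mul_one, ← eZa, shuffleSeries_one_left]
  rw [← sub_eq_zero]
  refine eq_zero_of_eq_letterSeries_mul (c := Letter.x) (r := 1) ?_
  rw [← hx, one_smul]
  set T := shuffleSeries Z (x * W) with hT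
  set S := shuffleSeries Z V with hS
  set Qa := zSeries wTwo a with hQa
  set Qb := zSeries wTwo b with hQb
  set Zb := zSeries wOne b with hZb
  -- Multiplication by 1 - x t sends Z to y t and Q to y t + x t Q, so the right-hand side can be
  -- tested against the equation for T without inverting 1 - x t.
  have e1 : (1 - x) * (Qa - Z) = x * Qa := by
    calc (1 - x) * (Qa - Z) = Qa - x * Qa - (Z - x * Z) := by noncomm_ring
      _ = x * Qa := by
        nth_rewrite 1 [eQa]
        nth_rewrite 1 [eZa]
        abel
  have e2 : (1 - x) * (Qb - Zb) = x * Qb := by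
    calc (1 - x) * (Qb - Zb) = Qb - x * Qb - (Zb - x * Zb) := by noncomm_ring
      _ = x * Qb := by
        nth_rewrite 1 [eQb]
        nth_rewrite 1 [eZb]
        abel
  have e3 : (1 - x) * Z = ya := by
    rw [sub_mul, one_mul, sub_eq_iff_eq_add]
    exact eZa
  have e4 : (1 - x) * T = ya * (x * W) + x * (Qa * W + Qb * S) := by
    rw [← eS, sub_mul, one_mul, sub_eq_iff_eq_add]
    nth_rewrite 1 [e]
    abel
  have : (1 - x) * (T - ((Qa - Z) * W + (Qb - Zb) * S + Z * (x * W))) = 0 := by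
    rw [mul_sub, mul_add, mul_add, e4, ← mul_assoc (1 - x) _ W, e1, ← mul_assoc (1 - x) _ S, e2,
      ← mul_assoc (1 - x) Z, e3]
    noncomm_ring
  rw [sub_mul, one_mul, sub_eq_zero] at this
  exact this

/-! ### Insertion of a label -/

/-- The labels `c₁, …, c_{i-1}, a, c_i, c_{i+1}, …`, for `i ≥ 1`. -/
def insertAt (a : ZMod N) (c : ℕ → ZMod N) (i j : ℕ) : ZMod N :=
  if j < i then c j else if j = i then a else c (j - 1)

/-- The weights `2^{k-1}` at the positions `1, …, i` and `1` at the others. -/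
def wTwoUpTo (i j : ℕ) : ℕ → ℚ := if j ≤ i then wTwo else wOne

theorem insertAt_succ_succ (a : ZMod N) (c : ℕ → ZMod N) {i j : ℕ} (hj : 1 ≤ j) :
    insertAt a c (i + 1) (j + 1) = insertAt a (fun j => c (j + 1)) i j := by
  unfold insertAt
  split_ifs <;> first | omega | rfl | (congr 1; omega)

theorem zSeriesProd_insertAt_one (m : ℕ) (w : ℕ → ℕ → ℚ) (a : ZMod N) (c : ℕ → ZMod N) :
    zSeriesProd (m + 1) w (insertAt a c 1) =
      zSeries (w 1) a * zSeriesProd m (fun j => w (j + 1)) c := by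
  rw [zSeriesProd_succ]
  congr 1

theorem zSeriesProd_insertAt_succ (m i : ℕ) (hi : 1 ≤ i) (w : ℕ → ℕ → ℚ) (a : ZMod N)
    (c : ℕ → ZMod N) :
    zSeriesProd (m + 1) w (insertAt a c (i + 1)) =
      zSeries (w 1) (c 1) *
        zSeriesProd m (fun j => w (j + 1)) (insertAt a (fun j => c (j + 1)) i) := by
  rw [zSeriesProd_succ]
  congr 1
  · rw [insertAt, if_pos (by omega)]
  · exact zSeriesProd_congr (fun _ _ _ => rfl) fun j h _ => insertAt_succ_succ a c h

/-- Each use of the recursion either places `a` now or passes one block with weight 2^{k-1}. All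
blocks up to and including the inserted one are doubled, except that `a` in last place keeps weight
1, since Z_a ш 1 = Z_a. -/
theorem shuffleSeries_zSeriesProd (m : ℕ) (a : ZMod N) (c : ℕ → ZMod N) :
    shuffleSeries (zSeries wOne a) (zSeriesProd m (fun _ => wOne) c) =
      ∑ i ∈ Finset.range m, zSeriesProd (m + 1) (wTwoUpTo (i + 1)) (insertAt a c (i + 1)) +
        zSeriesProd (m + 1) (wTwoUpTo m) (insertAt a c (m + 1)) := by
  induction m generalizing c with
  | zero =>
    rw [zSeriesProd_zero, shuffleSeries_one_right, Finset.range_zero, Finset.sum_empty, zero_add,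
      zSeriesProd_succ, zSeriesProd_zero, mul_one]
    simp [wTwoUpTo, insertAt]
  | succ m ih =>
    have hshift : ∀ i, (fun j => wTwoUpTo (i + 1) (j + 1)) = wTwoUpTo i := fun i => by
      funext j
      simp [wTwoUpTo]
    have hstep : ∀ i i', zSeriesProd (m + 1 + 1) (wTwoUpTo (i + 1)) (insertAt a c (i' + 1 + 1)) =
        zSeries wTwo (c 1) *
          zSeriesProd (m + 1) (wTwoUpTo i) (insertAt a (fun j => c (j + 1)) (i' + 1)) :=
      fun i i' => by
        rw [zSeriesProd_insertAt_succ _ _ (by omega), hshift]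
        simp [wTwoUpTo]
    have h0 : zSeriesProd (m + 1) (wTwoUpTo 0) c = zSeries wOne (c 1) *
        zSeriesProd m (fun _ => wOne) fun j => c (j + 1) := by
      rw [zSeriesProd_succ]
      rfl
    rw [zSeriesProd_succ, shuffleSeries_zSeries_mul, ih, Finset.sum_range_succ', mul_add,
      Finset.mul_sum]
    simp only [hstep]
    rw [zero_add, zSeriesProd_insertAt_one, hshift, h0]
    simp only [wTwoUpTo, le_refl, if_true]
    abel

/-! ### The harmonic product on generating series -/

theorem zBasis_nil : (zBasis [] : A1 N) = ⟨1, Submodule.subset_span (Or.inl rfl)⟩ :=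
  Subtype.ext (by rw [coe_zBasis]; rfl)

theorem z1_eq_zBasis (l : ℕ+) (a : ZMod N) : z1 l a = zBasis [(l, a)] :=
  Subtype.ext (by rw [coe_zBasis]; simp [z1, ofZWord])

theorem harmonicProd_zBasis (v w : ZWord N) :
    harmonicProd (zBasis v) (zBasis w) = harmonicWord v w := by
  simp [harmonicProd, Module.Basis.constr_basis]

theorem consZ_zBasis (k : ℕ+) (a : ZMod N) (w : ZWord N) :
    consZ k a (zBasis w) = zBasis ((k, a) :: w) := by
  simp [consZ, Module.Basis.constr_basis]

theorem harmonicProd_single_nil (p : ℕ+ × ZMod N) :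
    harmonicProd (zBasis [p]) (zBasis []) = zBasis [p] := by
  rw [harmonicProd_zBasis, harmonicWord]

theorem harmonicProd_single_consZ (l k : ℕ+) (a b : ZMod N) (v : A1 N) :
    harmonicProd (zBasis [(l, a)]) (consZ k b v) =
      consZ l a (consZ k b v) + consZ k b (harmonicProd (zBasis [(l, a)]) v) +
        consZ (l + k) (a + b) v := by
  have h : harmonicProd (zBasis [(l, a)]) ∘ₗ consZ k b =
      consZ l a ∘ₗ consZ k b + consZ k b ∘ₗ harmonicProd (zBasis [(l, a)]) +
        consZ (l + k) (a + b) := by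
    refine zBasis.ext fun w => ?_
    simp only [LinearMap.comp_apply, LinearMap.add_apply, consZ_zBasis, harmonicProd_zBasis]
    rw [harmonicWord, harmonicWord, harmonicWord, consZ_zBasis, consZ_zBasis]
  exact LinearMap.congr_fun h v

variable (N) in
/-- A linear projection of `𝒜` onto `𝒜¹`. -/
def projA1 : A N →ₗ[ℚ] A1 N :=
  (A1 N).subtype.exists_leftInverse_of_injective (A1 N).ker_subtype |>.choose

theorem projA1_coe (p : A1 N) : projA1 N (p : A N) = p :=
  LinearMap.congr_fun
    ((A1 N).subtype.exists_leftInverse_of_injective (A1 N).ker_subtype).choose_spec p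

variable (N) in
/-- A bilinear extension of the harmonic product to `𝒜`. -/
def harmonicExt : A N →ₗ[ℚ] A N →ₗ[ℚ] A N :=
  (harmonicProd.compl₁₂ (projA1 N) (projA1 N)).compr₂ (A1 N).subtype

/-- `bilSeries` requires a bilinear map on all of 𝒜. The choice of projection is harmless, because
the extension is only evaluated on 𝒜¹. -/
theorem harmonicExt_coe (p q : A1 N) : harmonicExt N (p : A N) q = (harmonicProd p q : A1 N) := by
  simp [harmonicExt, projA1_coe]

theorem harmonicExt_z_one (l : ℕ+) (a : ZMod N) : harmonicExt N (z l a) 1 = z l a := by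
  have h := harmonicExt_coe (z1 (l : ℕ) a) (zBasis [])
  rw [zBasis_nil] at h
  change harmonicExt N (z l a) 1 = _ at h
  rw [h, ← zBasis_nil, z1_eq_zBasis, harmonicProd_single_nil, ← z1_eq_zBasis]
  rfl

theorem harmonicExt_z_mul (l k : ℕ+) (a b : ZMod N) {v : A N} (hv : v ∈ A1 N) :
    harmonicExt N (z l a) (z k b * v) =
      z l a * (z k b * v) + z k b * harmonicExt N (z l a) v + z (l + k) (a + b) * v := by
  have h := congrArg (Subtype.val) (harmonicProd_single_consZ l k a b ⟨v, hv⟩)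
  rw [← harmonicExt_coe] at h
  simp only [Submodule.coe_add, coe_consZ] at h
  rw [← harmonicExt_coe, ← z1_eq_zBasis] at h
  simpa [z1] using h

/-- The harmonic product of power series. -/
abbrev harmonicSeries (F G : PowerSeries (A N)) : PowerSeries (A N) := bilSeries (harmonicExt N) F G

/-- The weight `k ↦ ∑_{l + p = k, l ≥ 1} g(p)`. -/
def wSum (g : ℕ → ℚ) (k : ℕ) : ℚ := ∑ p ∈ antidiagonal k, wOne p.1 * g p.2

theorem sum_antidiagonal_assoc {M : Type*} [AddCommMonoid M] (f : ℕ → ℕ → ℕ → M) (k : ℕ) :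
    ∑ p ∈ antidiagonal k, ∑ q ∈ antidiagonal p.2, f p.1 q.1 q.2 =
      ∑ p ∈ antidiagonal k, ∑ q ∈ antidiagonal p.1, f q.1 q.2 p.2 := by
  rw [Finset.sum_sigma', Finset.sum_sigma']
  refine Finset.sum_bij' (fun x _ => ⟨(x.1.1 + x.2.1, x.2.2), (x.1.1, x.2.1)⟩)
    (fun x _ => ⟨(x.2.1, x.2.2 + x.1.2), (x.2.2, x.1.2)⟩) ?_ ?_ ?_ ?_ ?_
  all_goals
    rintro ⟨⟨p1, p2⟩, ⟨q1, q2⟩⟩ h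
    simp only [Finset.mem_sigma, Finset.HasAntidiagonal.mem_antidiagonal] at h ⊢
  · exact ⟨by omega, trivial⟩
  · exact ⟨by omega, trivial⟩
  · obtain ⟨-, rfl⟩ := h
    rfl
  · obtain ⟨-, rfl⟩ := h
    rfl

theorem coeff_mul_zSeries (g : ℕ → ℚ) (b : ZMod N) (V : PowerSeries (A N)) (k : ℕ) :
    coeff k (zSeries g b * V) = ∑ p ∈ antidiagonal k, g p.1 • (z p.1 b * coeff p.2 V) := by
  rw [PowerSeries.coeff_mul]
  simp [zSeries]

/-- The merged letter has exponent l + p, so its weight is the convolution of the two weights. The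
coefficients of `V` must lie in 𝒜¹, where the recursion for ∗ is available. -/
theorem harmonicSeries_zSeries_mul (a b : ZMod N) {g : ℕ → ℚ} (hg : g 0 = 0)
    {V : PowerSeries (A N)} (hV : ∀ k, coeff k V ∈ A1 N) :
    harmonicSeries (zSeries wOne a) (zSeries g b * V) =
      zSeries wOne a * (zSeries g b * V) + zSeries g b * harmonicSeries (zSeries wOne a) V +
        zSeries (wSum g) (a + b) * V := by
  have key : ∀ l p (v : A N), v ∈ A1 N → harmonicExt N (wOne l • z l a) (g p • (z p b * v)) =
      wOne l • (z l a * (g p • (z p b * v))) +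
        g p • (z p b * harmonicExt N (wOne l • z l a) v) +
        (wOne l * g p) • (z (l + p) (a + b) * v) := by
    intro l p v hv
    rcases Nat.eq_zero_or_pos l with rfl | hl
    · simp [wOne]
    rcases Nat.eq_zero_or_pos p with rfl | hp
    · simp [hg]
    have h := harmonicExt_z_mul ⟨l, hl⟩ ⟨p, hp⟩ a b hv
    simp only [PNat.mk_coe] at h
    simp only [map_smul, LinearMap.smul_apply, h, mul_smul_comm, smul_add, smul_smul,
      mul_comm (g p)]
  ext k
  simp only [map_add]
  rw [coeff_mul_zSeries, coeff_mul_zSeries, coeff_mul_zSeries]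
  simp only [harmonicSeries, bilSeries, PowerSeries.coeff_mk, coeff_mul_zSeries, map_sum,
    Finset.mul_sum, Finset.smul_sum]
  have h1 : ∀ i, coeff i (zSeries wOne a) = wOne i • z i a := fun i => by simp [zSeries]
  simp only [h1, key _ _ _ (hV _), Finset.sum_add_distrib]
  congr 1
  · congr 1
    -- Both sides are sums over l + p + q = k that differ only in whether l or p is split off first.
    rw [sum_antidiagonal_assoc (fun l p q =>
        g p • (z p b * harmonicExt N (wOne l • z l a) (coeff q V))),
      sum_antidiagonal_assoc (fun p l q =>
        g p • (z p b * harmonicExt N (wOne l • z l a) (coeff q V)))]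
    refine Finset.sum_congr rfl fun p _ => ?_
    rw [← Finset.Nat.sum_antidiagonal_swap]
    rfl
  · rw [sum_antidiagonal_assoc (fun l p q =>
        (wOne l * g p) • (z (l + p) (a + b) * coeff q V))]
    refine Finset.sum_congr rfl fun p _ => ?_
    rw [wSum, Finset.sum_smul]
    refine Finset.sum_congr rfl fun q hq => ?_
    rw [Finset.HasAntidiagonal.mem_antidiagonal.1 hq]

theorem harmonicSeries_one (a : ZMod N) : harmonicSeries (zSeries wOne a) 1 = zSeries wOne a := by
  ext k
  simp only [harmonicSeries, bilSeries, PowerSeries.coeff_mk]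
  rw [Finset.sum_eq_single (k, 0)]
  · rcases Nat.eq_zero_or_pos k with rfl | hk
    · simp [zSeries, wOne]
    · have h := harmonicExt_z_one ⟨k, hk⟩ a
      simp only [PNat.mk_coe] at h
      simp [zSeries, h]
  · rintro ⟨i, j⟩ hij hne
    have : j ≠ 0 := by
      rintro rfl
      simp at hij
      simp [hij] at hne
    simp [PowerSeries.coeff_one, this]
  · simp

/-- The weights `k - 1` at the position `i` and `1` at the others. -/
def wSumAt (i j : ℕ) : ℕ → ℚ := if j = i then wSum wOne else wOne

/-- The labels `c₁, …, c_{i-1}, a + c_i, c_{i+1}, …`. -/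
def addAt (a : ZMod N) (c : ℕ → ZMod N) (i j : ℕ) : ZMod N := if j = i then a + c i else c j

/-- The letter labelled `a` is either inserted into one of the m + 1 gaps or merged with one of the
m letters. -/
theorem harmonicSeries_zSeriesProd (m : ℕ) (a : ZMod N) (c : ℕ → ZMod N) :
    harmonicSeries (zSeries wOne a) (zSeriesProd m (fun _ => wOne) c) =
      ∑ i ∈ Finset.range (m + 1), zSeriesProd (m + 1) (fun _ => wOne) (insertAt a c (i + 1)) +
        ∑ i ∈ Finset.range m, zSeriesProd m (wSumAt (i + 1)) (addAt a c (i + 1)) := by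
  induction m generalizing c with
  | zero =>
    rw [zSeriesProd_zero, harmonicSeries_one, Finset.sum_range_one, zSeriesProd_succ,
      zSeriesProd_zero, mul_one]
    simp [insertAt]
  | succ m ih =>
    have hins : ∀ i, zSeriesProd (m + 1 + 1) (fun _ => wOne) (insertAt a c (i + 1 + 1)) =
        zSeries wOne (c 1) *
          zSeriesProd (m + 1) (fun _ => wOne) (insertAt a (fun j => c (j + 1)) (i + 1)) :=
      fun i => zSeriesProd_insertAt_succ _ _ (by omega) _ _ _
    have hadd : ∀ i, zSeriesProd (m + 1) (wSumAt (i + 1 + 1)) (addAt a c (i + 1 + 1)) =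
        zSeries wOne (c 1) *
          zSeriesProd m (wSumAt (i + 1)) (addAt a (fun j => c (j + 1)) (i + 1)) := fun i => by
      rw [zSeriesProd_succ]
      congr 1
      exact zSeriesProd_congr (fun j _ _ => by simp [wSumAt]) (fun j _ _ => by simp [addAt])
    have hadd0 : zSeriesProd (m + 1) (wSumAt 1) (addAt a c 1) =
        zSeries (wSum wOne) (a + c 1) *
          zSeriesProd m (fun _ => wOne) (fun j => c (j + 1)) := by
      rw [zSeriesProd_succ]
      congr 1
    have hins' := Finset.sum_range_succ' (fun i =>
      zSeriesProd (m + 1 + 1) (fun _ => wOne) (insertAt a c (i + 1))) (m + 1)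
    have hadd' := Finset.sum_range_succ' (fun i =>
      zSeriesProd (m + 1) (wSumAt (i + 1)) (addAt a c (i + 1))) m
    simp only [hins, hadd, ← Finset.mul_sum, zero_add, hadd0, zSeriesProd_insertAt_one,
      zSeriesProd_succ m (fun _ => wOne) c] at hins' hadd'
    rw [hins', hadd', zSeriesProd_succ, harmonicSeries_zSeries_mul a _ (by simp [wOne])
      (fun k => coeff_zSeriesProd_mem_A1 _ k _ _), ih, mul_add]
    abel

/-! ### The inverse of `ℐ` on products -/

/-- The list of pairs underlying `z_{κ₁,c₁} ⋯ z_{κₙ,cₙ}`. -/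
def zList (n : ℕ) (κ : ℕ → ℕ) (c : ℕ → ZMod N) : ZWord N :=
  (List.range n).map fun j => ((κ (j + 1) - 1).succPNat, c (j + 1))

theorem zList_succ (n : ℕ) (κ : ℕ → ℕ) (c : ℕ → ZMod N) :
    zList (n + 1) κ c =
      ((κ 1 - 1).succPNat, c 1) :: zList n (fun j => κ (j + 1)) (fun j => c (j + 1)) := by
  simp [zList, List.range_succ_eq_map, List.map_map, Function.comp_def]

/-- No positivity of κ is needed: truncated subtraction gives `z 0 = z 1`, and `succPNat` of κ - 1
also sends 0 to 1. -/
theorem zProd1_eq_zBasis (n : ℕ) (κ : ℕ → ℕ) (c : ℕ → ZMod N) :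
    zProd1 n κ c = zBasis (zList n κ c) := by
  refine Subtype.ext ?_
  change zProd n κ c = _
  rw [coe_zBasis, zProd, ofZWord, zList, List.map_map]
  congr 1

theorem differences_zList (n : ℕ) (κ : ℕ → ℕ) (c : ℕ → ZMod N) (s : ZMod N) :
    differences s (zList n κ c) =
      zList n κ fun j => if j = 1 then c 1 - s else c j - c (j - 1) := by
  induction n generalizing κ c s with
  | zero => rfl
  | succ n ih =>
    rw [zList_succ, zList_succ, differences, ih]
    congr 1
    unfold zList
    refine List.map_congr_left fun j _ => ?_
    cases j <;> simp

theorem calI_symm_zBasis (w : ZWord N) : calI.symm (zBasis w) = zBasis (differences 0 w) := by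
  rw [LinearEquiv.symm_apply_eq, calI, Module.Basis.equiv_apply]
  exact congrArg _ (partialSums_differences 0 w).symm

theorem calI_symm_zProd1 (n : ℕ) (κ : ℕ → ℕ) (c : ℕ → ZMod N) :
    calI.symm (zProd1 n κ c) = zProd1 n κ (diffLabel c) := by
  rw [zProd1_eq_zBasis, zProd1_eq_zBasis, calI_symm_zBasis, differences_zList]
  congr 1
  unfold zList
  refine List.map_congr_left fun j _ => ?_
  simp [diffLabel]

theorem calI_symm_z1 (l : ℕ) (a : ZMod N) : calI.symm (z1 l a) = z1 l a := by
  have h : z1 l a = zProd1 1 (fun _ => l) (fun _ => a) := Subtype.ext (by simp [z1, zProd1, zProd])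
  conv_lhs => rw [h, calI_symm_zProd1]
  exact Subtype.ext (by simp [z1, zProd1, zProd, diffLabel])

/-! ### The shuffle part of the weighted sum -/

/-- The combination of words coming from the shuffle product; `L i` are the labels of the words
in which the distinguished label stands at position `i`. -/
def shufflePart (n k : ℕ) (L : ℕ → ℕ → ZMod N) : A1 N :=
  (∑ κ ∈ comps (Finset.Icc 1 n) k with 2 ≤ κ 2,
      (2 : ℚ) ^ (κ 1 - 1) • zProd1 n κ (L 1))
  + (∑ κ ∈ comps (Finset.Icc 1 n) k with 2 ≤ κ 1 ∧ κ 2 = 1,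
      ((2 : ℚ) ^ (κ 1 - 1) - 1) • zProd1 n κ (L 1))
  + (∑ i ∈ Finset.Icc 2 (n - 1), ∑ κ ∈ comps (Finset.Icc 1 n) k with 2 ≤ κ 1,
      ((2 : ℚ) ^ ((∑ j ∈ Finset.Icc 1 i, κ j) - i) -
        (2 : ℚ) ^ ((∑ j ∈ Finset.Icc 2 i, κ j) - (i - 1))) • zProd1 n κ (L i))
  + (∑ κ ∈ comps (Finset.Icc 1 n) k with 2 ≤ κ 1,
      ((2 : ℚ) ^ ((∑ j ∈ Finset.Icc 1 (n - 1), κ j) - (n - 1)) -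
        (2 : ℚ) ^ ((∑ j ∈ Finset.Icc 2 (n - 1), κ j) - (n - 2))) • zProd1 n κ (L n))

/-- The coefficients depend only on the exponents, so ℐ⁻¹ acts on the labels alone. -/
theorem calI_symm_shufflePart (n k : ℕ) (L : ℕ → ℕ → ZMod N) :
    calI.symm (shufflePart n k L) = shufflePart n k fun i => diffLabel (L i) := by
  simp only [shufflePart, map_add, map_sum, map_smul, calI_symm_zProd1]

theorem coe_zProd1 (n : ℕ) (κ : ℕ → ℕ) (c : ℕ → ZMod N) : (zProd1 n κ c : A N) = zProd n κ c := rfl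

theorem Icc_one_add_two (m : ℕ) :
    Finset.Icc 1 (m + 2) = insert 1 (insert 2 (Finset.Icc 3 (m + 2))) := by
  ext j
  simp only [Finset.mem_Icc, Finset.mem_insert]
  omega

theorem prod_Icc_one_add_two (m : ℕ) (f : ℕ → ℚ) (hf : ∀ j, 3 ≤ j → j ≤ m + 2 → f j = 1) :
    ∏ j ∈ Finset.Icc 1 (m + 2), f j = f 1 * f 2 := by
  rw [Icc_one_add_two, Finset.prod_insert (by simp), Finset.prod_insert (by simp),
    Finset.prod_eq_one (s := Finset.Icc 3 (m + 2)), mul_one]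
  intro j hj
  rw [Finset.mem_Icc] at hj
  exact hf j hj.1 hj.2

theorem wOne_of_pos {k : ℕ} (hk : 1 ≤ k) : wOne k = 1 := if_neg (by omega)

theorem wTwo_of_pos {k : ℕ} (hk : 1 ≤ k) : wTwo k = 2 ^ (k - 1) := if_neg (by omega)

/-- The weights of the words in which the distinguished label does not come first. -/
def wShuffle (i j : ℕ) : ℕ → ℚ := if j = 1 then wTwo - wOne else wTwoUpTo i j

/-- The coefficient factors as (2^{κ_1-1} - 1) ∏_{2≤j≤i} 2^{κ_j-1}. The first factor vanishes at κ_1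
= 1, so the condition κ_1 ≥ 2 comes for free. -/
theorem prod_wShuffle {n i : ℕ} (hi : 1 ≤ i) (hin : i ≤ n) {κ : ℕ → ℕ}
    (hκ : ∀ j ∈ Finset.Icc 1 n, 1 ≤ κ j) :
    (if 2 ≤ κ 1 then ((2 : ℚ) ^ ((∑ j ∈ Finset.Icc 1 i, κ j) - i) -
        (2 : ℚ) ^ ((∑ j ∈ Finset.Icc 2 i, κ j) - (i - 1))) else 0) =
      ∏ j ∈ Finset.Icc 1 n, wShuffle i j (κ j) := by
  have h1 : Finset.Icc 1 n = insert 1 (Finset.Icc 2 n) := by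
    ext j
    simp only [Finset.mem_Icc, Finset.mem_insert]
    omega
  have h2 : Finset.Icc 1 i = insert 1 (Finset.Icc 2 i) := by
    ext j
    simp only [Finset.mem_Icc, Finset.mem_insert]
    omega
  have hκ1 : 1 ≤ κ 1 := hκ 1 (by simp; omega)
  -- Positivity of the parts makes the truncated subtractions in the exponents genuine.
  have hsum : ∑ j ∈ Finset.Icc 2 i, κ j = ∑ j ∈ Finset.Icc 2 i, (κ j - 1) + (i - 1) := by
    have : i - 1 = ∑ j ∈ Finset.Icc 2 i, 1 := by simp
    rw [this, ← Finset.sum_add_distrib]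
    refine Finset.sum_congr rfl fun j hj => ?_
    rw [Finset.mem_Icc] at hj
    have := hκ j (by rw [Finset.mem_Icc]; omega)
    omega
  have hprod : ∏ j ∈ Finset.Icc 2 n, wShuffle i j (κ j) =
      2 ^ ∑ j ∈ Finset.Icc 2 i, (κ j - 1) := by
    rw [← Finset.prod_pow_eq_pow_sum]
    symm
    refine (Finset.prod_congr rfl fun j hj => ?_).trans
      (Finset.prod_subset (Finset.Icc_subset_Icc_right hin) fun j hj hj' => ?_)
    · rw [Finset.mem_Icc] at hj
      rw [wShuffle, if_neg (by omega), wTwoUpTo, if_pos (by omega),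
        wTwo_of_pos (hκ j (by rw [Finset.mem_Icc]; omega))]
    · rw [Finset.mem_Icc] at hj hj'
      rw [wShuffle, if_neg (by omega), wTwoUpTo, if_neg (by omega),
        wOne_of_pos (hκ j (by rw [Finset.mem_Icc]; omega))]
  rw [h1, Finset.prod_insert (by simp), hprod, wShuffle, if_pos rfl, Pi.sub_apply,
    wTwo_of_pos hκ1, wOne_of_pos hκ1, h2, Finset.sum_insert (by simp), hsum, sub_mul, one_mul,
    ← pow_add]
  split_ifs with h
  · congr 2 <;> omega
  · rw [show κ 1 = 1 by omega]
    simp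

theorem sum_comps_wShuffle {n i : ℕ} (hi : 1 ≤ i) (hin : i ≤ n) (k : ℕ) (c : ℕ → ZMod N) :
    ∑ κ ∈ comps (Finset.Icc 1 n) k with 2 ≤ κ 1,
      ((2 : ℚ) ^ ((∑ j ∈ Finset.Icc 1 i, κ j) - i) -
        (2 : ℚ) ^ ((∑ j ∈ Finset.Icc 2 i, κ j) - (i - 1))) • zProd n κ c =
      coeff k (zSeriesProd n (wShuffle i) c) :=
  sum_comps_smul_zProd c (fun j _ => by
    simp only [wShuffle, wTwoUpTo]
    split_ifs <;> simp [wTwo, wOne]) fun κ hκ => prod_wShuffle hi hin hκ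

theorem sum_Icc_two_eq_sum_range {M : Type*} [AddCommMonoid M] (m : ℕ) (f : ℕ → M) :
    ∑ i ∈ Finset.Icc 2 (m + 1), f i = ∑ i ∈ Finset.range m, f (i + 2) := by
  have h : Finset.Icc 2 (m + 1) = Finset.Ico 2 (m + 2) := by
    ext j
    simp only [Finset.mem_Icc, Finset.mem_Ico]
    omega
  rw [h, Finset.sum_Ico_eq_sum_range, Nat.add_sub_cancel]
  exact Finset.sum_congr rfl fun i _ => by rw [add_comm]

theorem sum_Icc_one_eq_sum_range {M : Type*} [AddCommMonoid M] (m : ℕ) (f : ℕ → M) :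
    ∑ i ∈ Finset.Icc 1 m, f i = ∑ i ∈ Finset.range m, f (i + 1) := by
  have h : Finset.Icc 1 m = Finset.Ico 1 (m + 1) := by
    ext j
    simp only [Finset.mem_Icc, Finset.mem_Ico]
    omega
  rw [h, Finset.sum_Ico_eq_sum_range, Nat.add_sub_cancel]
  exact Finset.sum_congr rfl fun i _ => by rw [add_comm]

/-- Words with `a` in front come from (Q_a - Z_a) Z_b V + Z_a G_b V, all others from (Q_b - Z_b)(Z_a
ш V), where b is the first label and V the product of the remaining series. -/
theorem coe_shufflePart (m k : ℕ) (a : ZMod N) (c : ℕ → ZMod N) :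
    (shufflePart (m + 2) k (insertAt a c) : A N) =
      coeff k (shuffleSeries (zSeries wOne a)
        (zSeries wGeTwo (c 1) * zSeriesProd m (fun _ => wOne) fun j => c (j + 1))) := by
  have e1 : ∑ κ ∈ comps (Finset.Icc 1 (m + 2)) k with 2 ≤ κ 2,
      (2 : ℚ) ^ (κ 1 - 1) • zProd (m + 2) κ (insertAt a c 1) =
      coeff k (zSeries wTwo a * (zSeries wGeTwo (c 1) *
        zSeriesProd m (fun _ => wOne) fun j => c (j + 1))) := by
    rw [sum_comps_smul_zProd (w := fun j => if j = 1 then wTwo else if j = 2 then wGeTwo else wOne)]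
    · rw [zSeriesProd_insertAt_one, zSeriesProd_succ]
      congr 2
    · intro j _
      split_ifs <;> simp [wTwo, wGeTwo, wOne]
    · intro κ hκ
      have hκ1 : 1 ≤ κ 1 := hκ 1 (by simp)
      rw [prod_Icc_one_add_two]
      · simp [wTwo_of_pos hκ1, wGeTwo]
      · intro j h3 hj
        rw [if_neg (by omega), if_neg (by omega), wOne_of_pos]
        exact hκ j (by rw [Finset.mem_Icc]; omega)
  have e2 : ∑ κ ∈ comps (Finset.Icc 1 (m + 2)) k with 2 ≤ κ 1 ∧ κ 2 = 1,
      ((2 : ℚ) ^ (κ 1 - 1) - 1) • zProd (m + 2) κ (insertAt a c 1) =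
      coeff k (zSeries (wTwo - wOne) a * (zSeries wEqOne (c 1) *
        zSeriesProd m (fun _ => wOne) fun j => c (j + 1))) := by
    rw [sum_comps_smul_zProd
      (w := fun j => if j = 1 then wTwo - wOne else if j = 2 then wEqOne else wOne)]
    · rw [zSeriesProd_insertAt_one, zSeriesProd_succ]
      congr 2
    · intro j _
      split_ifs <;> simp [wTwo, wEqOne, wOne]
    · intro κ hκ
      have hκ1 : 1 ≤ κ 1 := hκ 1 (by simp)
      rw [prod_Icc_one_add_two]
      · simp only [if_true, Pi.sub_apply, wTwo_of_pos hκ1, wOne_of_pos hκ1]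
        rw [if_neg (by omega : ¬ (2 = 1))]
        by_cases h : 2 ≤ κ 1
        · simp [h, wEqOne]
        · rw [show κ 1 = 1 by omega]
          simp
      · intro j h3 hj
        rw [if_neg (by omega), if_neg (by omega), wOne_of_pos]
        exact hκ j (by rw [Finset.mem_Icc]; omega)
  have hshift : ∀ i i', zSeriesProd (m + 2) (wShuffle (i + 1)) (insertAt a c (i' + 1 + 1)) =
      zSeries (wTwo - wOne) (c 1) *
        zSeriesProd (m + 1) (wTwoUpTo i) (insertAt a (fun j => c (j + 1)) (i' + 1)) :=
    fun i i' => by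
      rw [zSeriesProd_insertAt_succ _ _ (by omega)]
      congr 1
      exact zSeriesProd_congr (fun j _ _ => by
        rw [wShuffle, if_neg (by omega)]
        simp [wTwoUpTo]) fun _ _ _ => rfl
  rw [shuffleSeries_zSeries_wGeTwo_mul, shuffleSeries_zSeriesProd, shufflePart]
  simp only [Submodule.coe_add, AddSubmonoidClass.coe_finsetSum, Submodule.coe_smul, coe_zProd1]
  rw [e1, e2, show m + 2 - 1 = m + 1 from rfl, sum_Icc_two_eq_sum_range]
  rw [Finset.sum_congr rfl fun i hi => sum_comps_wShuffle (n := m + 2) (i := i + 2) (by omega)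
    (by rw [Finset.mem_range] at hi; omega) k (insertAt a c (i + 2))]
  -- When `a` stands last its block is not doubled, so the powers of 2 stop at position m + 1
  -- although the insertion is at m + 2.
  have e4 := sum_comps_wShuffle (n := m + 2) (i := m + 1) (by omega) (by omega) k
    (insertAt a c (m + 2))
  rw [show m + 1 - 1 = m from rfl] at e4
  rw [show m + 2 - 2 = m from rfl, e4, hshift, ← map_sum]
  rw [Finset.sum_congr rfl fun i _ => hshift (i + 1) i, ← Finset.mul_sum]
  simp only [← map_add]
  congr 1
  -- Splitting Z_b into G_b plus its k = 1 term turns the words with `a` in front into Q_a G_b V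
  -- plus (Q_a - Z_a) times that term times V: the cases k_2 ≥ 2 and k_2 = 1.
  rw [wOne_eq, zSeries_add _ _ (c 1), ← wOne_eq, zSeries_sub]
  noncomm_ring

/-! ### The harmonic part of the weighted sum -/

/-- The combination of words coming from the harmonic product. -/
def harmonicPart (n k : ℕ) (a : ZMod N) (α : ℕ → ZMod N) : A N :=
  (∑ κ ∈ comps (Finset.Icc 1 n) k with 2 ≤ κ 2, zProd n κ (insertLabel a α 0))
  + (∑ i ∈ Finset.Icc 1 (n - 1), ∑ κ ∈ comps (Finset.Icc 1 n) k with 2 ≤ κ 1,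
      zProd n κ (insertLabel a α i))
  + (∑ κ ∈ comps (Finset.Icc 1 (n - 1)) k with 2 ≤ κ 1,
      ((κ 1 : ℚ) - 2) • zProd (n - 1) κ (addLabel a α 1))
  + (∑ i ∈ Finset.Icc 2 (n - 1), ∑ κ ∈ comps (Finset.Icc 1 (n - 1)) k with 2 ≤ κ 1,
      ((κ i : ℚ) - 1) • zProd (n - 1) κ (addLabel a α i))

/-- Counts the pairs l + p = k with l, p ≥ 1. -/
theorem wSum_wOne {k : ℕ} (hk : 1 ≤ k) : wSum wOne k = k - 1 := by
  obtain ⟨j, rfl⟩ := Nat.exists_eq_add_of_le' hk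
  rw [wSum, Finset.Nat.sum_antidiagonal_eq_sum_range_succ (fun p q => wOne p * wOne q),
    Finset.sum_range_succ, Finset.sum_range_succ',
    Finset.sum_congr rfl (g := fun _ => (1 : ℚ))]
  · simp [wOne]
  · intro i hi
    rw [Finset.mem_range] at hi
    rw [wOne_of_pos (by omega), wOne_of_pos (by omega), mul_one]

/-- Counts the pairs l + p = k with l ≥ 1, p ≥ 2. The case k = 1 is separate, as k - 2 would be
negative there. -/
theorem wSum_wGeTwo {k : ℕ} (hk : 1 ≤ k) : wSum wGeTwo k = if 2 ≤ k then (k : ℚ) - 2 else 0 := by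
  obtain ⟨j, rfl⟩ := Nat.exists_eq_add_of_le' hk
  cases j with
  | zero => simp [wSum, wGeTwo, Finset.Nat.antidiagonal_succ]
  | succ j =>
    rw [wSum, Finset.Nat.sum_antidiagonal_eq_sum_range_succ (fun p q => wOne p * wGeTwo q),
      Finset.sum_range_succ, Finset.sum_range_succ, Finset.sum_range_succ',
      Finset.sum_congr rfl (g := fun _ => (1 : ℚ))]
    · simp [wOne, wGeTwo]
      ring
    · intro i hi
      rw [Finset.mem_range] at hi
      rw [wOne_of_pos (by omega), wGeTwo, if_pos (by omega), mul_one]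

theorem wSum_zero (g : ℕ → ℚ) : wSum g 0 = 0 := by simp [wSum, wOne]

theorem insertLabel_eq_insertAt (a : ZMod N) (α : ℕ → ZMod N) (i : ℕ) :
    insertLabel a α i = insertAt a (diffLabel α) (i + 1) := by
  funext j
  simp [insertLabel, insertAt]

/-- The first step of the recursion has the special weight of k_1 ≥ 2: `a` goes in front (`e5`),
later (`e6`, `e8`), or is merged with the first letter (`e7`). -/
theorem harmonicPart_eq_coeff (m k : ℕ) (a : ZMod N) (α : ℕ → ZMod N) :
    harmonicPart (m + 2) k a α =
      coeff k (harmonicSeries (zSeries wOne a)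
        (zSeries wGeTwo (diffLabel α 1) *
          zSeriesProd m (fun _ => wOne) fun j => diffLabel α (j + 1))) := by
  have e5 : ∑ κ ∈ comps (Finset.Icc 1 (m + 2)) k with 2 ≤ κ 2,
      zProd (m + 2) κ (insertLabel a α 0) =
      coeff k (zSeries wOne a * (zSeries wGeTwo (diffLabel α 1) *
        zSeriesProd m (fun _ => wOne) fun j => diffLabel α (j + 1))) := by
    have h := sum_comps_smul_zProd (n := m + 2) (k := k) (P := fun κ => 2 ≤ κ 2) (f := fun _ => 1)
      (w := fun j => if j = 2 then wGeTwo else wOne) (insertLabel a α 0)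
      (fun j _ => by split_ifs <;> simp [wGeTwo, wOne]) fun κ hκ => ?_
    · simp only [one_smul] at h
      rw [h, insertLabel_eq_insertAt, zSeriesProd_insertAt_one, zSeriesProd_succ]
      congr 2
    · rw [prod_Icc_one_add_two]
      · simp [wOne_of_pos (hκ 1 (by simp)), wGeTwo]
      · intro j h3 hj
        rw [if_neg (by omega), wOne_of_pos]
        exact hκ j (by rw [Finset.mem_Icc]; omega)
  have e6 : ∀ i, ∑ κ ∈ comps (Finset.Icc 1 (m + 2)) k with 2 ≤ κ 1,
      zProd (m + 2) κ (insertLabel a α (i + 1)) =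
      coeff k (zSeries wGeTwo (diffLabel α 1) *
        zSeriesProd (m + 1) (fun _ => wOne)
          (insertAt a (fun j => diffLabel α (j + 1)) (i + 1))) := by
    intro i
    have h := sum_comps_smul_zProd (n := m + 2) (k := k) (P := fun κ => 2 ≤ κ 1) (f := fun _ => 1)
      (w := fun j => if j = 1 then wGeTwo else wOne) (insertLabel a α (i + 1))
      (fun j _ => by split_ifs <;> simp [wGeTwo, wOne]) fun κ hκ => ?_
    · simp only [one_smul] at h
      rw [h, insertLabel_eq_insertAt, zSeriesProd_insertAt_succ _ _ (by omega)]
      congr 2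
    · rw [prod_Icc_one_add_two]
      · simp [wOne_of_pos (hκ 2 (by simp)), wGeTwo]
      · intro j h3 hj
        rw [if_neg (by omega), wOne_of_pos]
        exact hκ j (by rw [Finset.mem_Icc]; omega)
  have hIcc : Finset.Icc 1 (m + 1) = insert 1 (Finset.Icc 2 (m + 1)) := by
    ext j
    simp only [Finset.mem_Icc, Finset.mem_insert]
    omega
  have e7 : ∑ κ ∈ comps (Finset.Icc 1 (m + 1)) k with 2 ≤ κ 1,
      ((κ 1 : ℚ) - 2) • zProd (m + 1) κ (addLabel a α 1) =
      coeff k (zSeries (wSum wGeTwo) (a + diffLabel α 1) *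
        zSeriesProd m (fun _ => wOne) fun j => diffLabel α (j + 1)) := by
    rw [sum_comps_smul_zProd (w := fun j => if j = 1 then wSum wGeTwo else wOne)]
    · rw [zSeriesProd_succ]
      congr 2
    · intro j _
      split_ifs
      · exact wSum_zero _
      · simp [wOne]
    · intro κ hκ
      rw [hIcc, Finset.prod_insert (by simp), Finset.prod_eq_one (s := Finset.Icc 2 (m + 1))]
      · simp [wSum_wGeTwo (hκ 1 (by simp))]
      · intro j hj
        rw [Finset.mem_Icc] at hj
        rw [if_neg (by omega), wOne_of_pos]
        exact hκ j (by rw [Finset.mem_Icc]; omega)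
  have e8 : ∀ i ∈ Finset.range m, ∑ κ ∈ comps (Finset.Icc 1 (m + 1)) k with 2 ≤ κ 1,
      ((κ (i + 2) : ℚ) - 1) • zProd (m + 1) κ (addLabel a α (i + 2)) =
      coeff k (zSeries wGeTwo (diffLabel α 1) *
        zSeriesProd m (wSumAt (i + 1)) (addAt a (fun j => diffLabel α (j + 1)) (i + 1))) := by
    intro i hi
    rw [Finset.mem_range] at hi
    rw [sum_comps_smul_zProd (w := fun j => if j = 1 then wGeTwo else wSumAt (i + 2) j)]
    · rw [zSeriesProd_succ]
      congr 2
      · refine zSeriesProd_congr (fun j h _ => ?_) fun j _ _ => ?_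
        · rw [if_neg (by omega)]
          simp [wSumAt]
        · simp [addLabel, addAt]
    · intro j _
      simp only [wSumAt]
      split_ifs
      · simp [wGeTwo]
      · exact wSum_zero _
      · simp [wOne]
    · intro κ hκ
      rw [hIcc, Finset.prod_insert (by simp), Finset.prod_eq_single (i + 2)]
      · have h1 : (if i + 2 = 1 then wGeTwo else wSumAt (i + 2) (i + 2)) = wSum wOne := by
          simp [wSumAt]
        rw [h1, if_pos rfl, wSum_wOne (hκ _ (by rw [Finset.mem_Icc]; omega)), wGeTwo]
        split_ifs <;> simp
      · intro j hj hne
        rw [Finset.mem_Icc] at hj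
        rw [if_neg (by omega), wSumAt, if_neg hne, wOne_of_pos]
        exact hκ j (by rw [Finset.mem_Icc]; omega)
      · intro h
        exact absurd (by rw [Finset.mem_Icc]; omega) h
  rw [harmonicSeries_zSeries_mul a _ (by simp [wGeTwo])
    (fun k => coeff_zSeriesProd_mem_A1 _ k _ _), harmonicSeries_zSeriesProd, harmonicPart,
    show m + 2 - 1 = m + 1 from rfl, e5, e7, sum_Icc_one_eq_sum_range, sum_Icc_two_eq_sum_range,
    Finset.sum_congr rfl e8, Finset.sum_congr rfl fun i _ => e6 i]
  simp only [← map_sum, ← map_add, ← Finset.mul_sum]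
  congr 1
  rw [mul_add]
  abel

/-! ### The weighted sum as a combination of double shuffle relations -/

theorem diffLabel_insertAt_one (a : ZMod N) (α : ℕ → ZMod N) {j : ℕ} (hj : 1 ≤ j) :
    diffLabel (insertAt a α 1) j = frontDiffLabel a α j := by
  obtain rfl | rfl | h : j = 1 ∨ j = 2 ∨ 3 ≤ j := by omega
  · simp [diffLabel, insertAt, frontDiffLabel]
  · simp [diffLabel, insertAt, frontDiffLabel]
  · simp only [diffLabel, insertAt, frontDiffLabel]
    split_ifs <;> first | omega | rfl

/-- An inserted label affects only the two differences in which it takes part. -/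
theorem diffLabel_insertAt (a : ZMod N) (α : ℕ → ZMod N) {i j : ℕ} (hi : 2 ≤ i) (hj : 1 ≤ j) :
    diffLabel (insertAt a α i) j = midDiffLabel a α i j := by
  simp only [diffLabel, insertAt, midDiffLabel]
  split_ifs <;> first | omega | rfl | (subst_vars; rfl)

theorem diffLabel_insertAt_last (a : ZMod N) (α : ℕ → ZMod N) {n j : ℕ} (hn : 2 ≤ n)
    (hj : 1 ≤ j) (hjn : j ≤ n) :
    diffLabel (insertAt a α n) j = backDiffLabel a α n j := by
  rw [diffLabel_insertAt a α hn hj]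
  simp only [midDiffLabel, backDiffLabel]
  split_ifs <;> first | omega | rfl

theorem weightedSum_eq (n k : ℕ) (hn : 2 ≤ n) (a : ZMod N) (α : ℕ → ZMod N) :
    weightedSum n k a α =
      (shufflePart n k fun i => diffLabel (insertAt a α i) : A1 N) - harmonicPart n k a α := by
  have h1 : ∀ κ, zProd n κ (diffLabel (insertAt a α 1)) = zProd n κ (frontDiffLabel a α) :=
    fun κ => zProd_congr (fun _ _ _ => rfl) fun j hj _ => diffLabel_insertAt_one a α hj
  have h2 : ∀ i ∈ Finset.Icc 2 (n - 1), ∀ κ,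
      zProd n κ (diffLabel (insertAt a α i)) = zProd n κ (midDiffLabel a α i) :=
    fun i hi κ => zProd_congr (fun _ _ _ => rfl) fun j hj _ =>
      diffLabel_insertAt a α (Finset.mem_Icc.1 hi).1 hj
  have h3 : ∀ κ, zProd n κ (diffLabel (insertAt a α n)) = zProd n κ (backDiffLabel a α n) :=
    fun κ => zProd_congr (fun _ _ _ => rfl) fun j hj hjn => diffLabel_insertAt_last a α hn hj hjn
  rw [weightedSum, shufflePart, harmonicPart]
  simp only [Submodule.coe_add, AddSubmonoidClass.coe_finsetSum, Submodule.coe_smul, coe_zProd1,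
    h1, h3]
  rw [Finset.sum_congr (s₁ := Finset.Icc 2 (n - 1)) rfl fun i hi =>
    Finset.sum_congr rfl fun κ _ => by rw [← h2 i hi κ]]
  abel

theorem sum_doubleShuffle_eq_weightedSum (n k : ℕ) (hn : 2 ≤ n) (a : ZMod N) (α : ℕ → ZMod N) :
    ((∑ κ ∈ comps (Finset.Icc 0 (n - 1)) k with 2 ≤ κ 1,
        (calI.symm (shuffleA1 (z1 (κ 0) a) (zProd1 (n - 1) κ α)) -
          harmonicProd (calI.symm (z1 (κ 0) a)) (calI.symm (zProd1 (n - 1) κ α))) : A1 N) : A N) =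
      weightedSum n k a α := by
  obtain ⟨m, rfl⟩ := Nat.exists_eq_add_of_le' hn
  rw [show m + 2 - 1 = m + 1 from rfl, weightedSum_eq _ _ hn, Finset.sum_sub_distrib,
    Submodule.coe_sub, ← map_sum]
  congr 1
  · rw [← calI_symm_shufflePart]
    congr 2
    refine Subtype.ext ?_
    rw [coe_shufflePart, ← sum_comps_bilinear, AddSubmonoidClass.coe_finsetSum]
    rfl
  · rw [harmonicPart_eq_coeff, ← sum_comps_bilinear, AddSubmonoidClass.coe_finsetSum]
    refine Finset.sum_congr rfl fun κ _ => ?_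
    rw [calI_symm_z1, calI_symm_zProd1, ← harmonicExt_coe]
    rfl

/-! ### The characters `m ↦ ω^{am}` -/

/-- `ω^{am}`. -/
def chi (a : ZMod N) (m : ℕ) : ℂ := omega N ^ (a.val * m)

theorem chi_add_right (a : ZMod N) (m m' : ℕ) : chi a (m + m') = chi a m * chi a m' := by
  rw [chi, chi, chi, mul_add, pow_add]

theorem chi_zero_right (a : ZMod N) : chi a 0 = 1 := by simp [chi]

theorem isPrimitiveRoot_omega [NeZero N] : IsPrimitiveRoot (omega N) N :=
  Complex.isPrimitiveRoot_exp N (NeZero.ne N)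

theorem chi_add_left [NeZero N] (a b : ZMod N) (m : ℕ) : chi (a + b) m = chi a m * chi b m := by
  rw [chi, chi, chi, ← pow_add, ← add_mul, pow_mul, pow_mul, ZMod.val_add,
    ← pow_eq_pow_mod _ isPrimitiveRoot_omega.pow_eq_one]

theorem chi_zero_left (m : ℕ) : chi (0 : ZMod N) m = 1 := by simp [chi]

theorem chi_neg_mul [NeZero N] (a : ZMod N) (m : ℕ) : chi (-a) m * chi a m = 1 := by
  rw [← chi_add_left, neg_add_cancel, chi_zero_left]

theorem norm_chi [NeZero N] (a : ZMod N) (m : ℕ) : ‖chi a m‖ = 1 := by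
  rw [chi, norm_pow, isPrimitiveRoot_omega.norm'_eq_one (NeZero.ne N), one_pow]

theorem chi_one_ne_one [NeZero N] {b : ZMod N} (hb : b ≠ 0) : chi b 1 ≠ 1 := by
  rw [chi, mul_one]
  refine isPrimitiveRoot_omega.pow_ne_one_of_pos_of_lt ?_ (ZMod.val_lt b)
  rwa [Ne, ZMod.val_eq_zero]

/-! ### Truncated series and the harmonic product -/

/-- Summation may start at m = 0: since k > 0, that term is a division by zero, hence 0. -/
theorem LStarTrunc_cons (k : ℕ+) (a : ZMod N) (w : ZWord N) (M : ℕ) :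
    LStarTrunc ((k, a) :: w) M =
      ∑ m ∈ Finset.range M, chi a m / (m : ℂ) ^ (k : ℕ) * LStarTrunc w m := by
  rw [LStarTrunc]
  cases M with
  | zero => simp
  | succ M =>
    rw [Finset.range_eq_Ico, Finset.sum_eq_sum_Ico_succ_bot (Nat.succ_pos M)]
    simp [chi]

theorem LStarTrunc_cons_succ (k : ℕ+) (a : ZMod N) (w : ZWord N) (M : ℕ) :
    LStarTrunc ((k, a) :: w) (M + 1) =
      LStarTrunc ((k, a) :: w) M + chi a M / (M : ℂ) ^ (k : ℕ) * LStarTrunc w M := by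
  rw [LStarTrunc_cons, LStarTrunc_cons, Finset.sum_range_succ]

/-- The linear extension of the truncated series to `𝒜¹`. -/
def truncMap (M : ℕ) : A1 N →ₗ[ℚ] ℂ := zBasis.constr ℚ fun w => LStarTrunc w M

theorem truncMap_zBasis (M : ℕ) (w : ZWord N) : truncMap M (zBasis w) = LStarTrunc w M := by
  simp [truncMap, Module.Basis.constr_basis]

theorem truncMap_zero_consZ (k : ℕ+) (a : ZMod N) (p : A1 N) : truncMap 0 (consZ k a p) = 0 := by
  have h : truncMap 0 ∘ₗ consZ k a = 0 := by
    refine zBasis.ext fun w => ?_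
    simp [consZ_zBasis, truncMap_zBasis, LStarTrunc]
  exact LinearMap.congr_fun h p

theorem truncMap_succ_consZ (M : ℕ) (k : ℕ+) (a : ZMod N) (p : A1 N) :
    truncMap (M + 1) (consZ k a p) =
      truncMap M (consZ k a p) + chi a M / (M : ℂ) ^ (k : ℕ) * truncMap M p := by
  have h : truncMap (M + 1) ∘ₗ consZ k a =
      truncMap M ∘ₗ consZ k a +
        LinearMap.mulLeft ℚ (chi a M / (M : ℂ) ^ (k : ℕ)) ∘ₗ truncMap M := by
    refine zBasis.ext fun w => ?_
    simp only [LinearMap.comp_apply, LinearMap.add_apply, consZ_zBasis, truncMap_zBasis,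
      LinearMap.mulLeft_apply, LStarTrunc_cons_succ]
  exact LinearMap.congr_fun h p

/-- Passing from M to M + 1 adds the terms whose largest index equals M in the first factor, in the
second, or in both; these match the three terms of the harmonic recursion. -/
theorem truncMap_harmonicWord [NeZero N] (M : ℕ) (v w : ZWord N) :
    truncMap M (harmonicWord v w) = LStarTrunc v M * LStarTrunc w M := by
  induction M generalizing v w with
  | zero =>
    match v, w with
    | [], w => rw [harmonicWord, truncMap_zBasis, LStarTrunc, one_mul]
    | p :: v, [] => rw [harmonicWord, truncMap_zBasis, LStarTrunc.eq_1, mul_one]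
    | (k, a) :: v, (l, b) :: w =>
      rw [harmonicWord]
      simp [truncMap_zero_consZ, LStarTrunc]
  | succ M ih =>
    match v, w with
    | [], w => rw [harmonicWord, truncMap_zBasis, LStarTrunc, one_mul]
    | p :: v, [] => rw [harmonicWord, truncMap_zBasis, LStarTrunc.eq_1, mul_one]
    | (k, a) :: v, (l, b) :: w =>
      have h := ih ((k, a) :: v) ((l, b) :: w)
      rw [harmonicWord, map_add, map_add] at h
      rw [harmonicWord, map_add, map_add, truncMap_succ_consZ, truncMap_succ_consZ,
        truncMap_succ_consZ, ih, ih, ih, LStarTrunc_cons_succ, LStarTrunc_cons_succ, chi_add_left,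
        PNat.add_coe, pow_add, ← div_mul_div_comm]
      linear_combination h

theorem truncMap_harmonicProd [NeZero N] (M : ℕ) (p q : A1 N) :
    truncMap M (harmonicProd p q) = truncMap M p * truncMap M q := by
  have h : (harmonicProd (N := N)).compr₂ (truncMap M) =
      (LinearMap.mul ℚ ℂ).compl₁₂ (truncMap M) (truncMap M) := by
    refine zBasis.ext fun v => zBasis.ext fun w => ?_
    simp [harmonicProd_zBasis, truncMap_harmonicWord, truncMap_zBasis]
  exact LinearMap.congr_fun₂ h p q

/-! ### Power series and the shuffle product -/

/-- The kernel of the differential form attached to a letter. -/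
def letterKernel : Letter N → PowerSeries ℂ
  | Letter.x => 1
  | Letter.y a => mk fun m => if m = 0 then 0 else chi a m

/-- The iterated integral of a series against the form attached to a letter. -/
def letterIntegral (c : Letter N) : PowerSeries ℂ →ₗ[ℚ] PowerSeries ℂ where
  toFun f := mk fun m => coeff m (letterKernel c * f) / (m : ℂ)
  map_add' f g := by
    ext m
    simp [mul_add, add_div]
  map_smul' r f := by
    ext m
    have h : letterKernel c * (r • f) = r • (letterKernel c * f) := mul_smul_comm _ _ _
    simp only [h, PowerSeries.coeff_mk, RingHom.id_apply, PowerSeries.coeff_smul, smul_div_assoc]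

theorem coeff_letterIntegral (c : Letter N) (f : PowerSeries ℂ) (m : ℕ) :
    coeff m (letterIntegral c f) = coeff m (letterKernel c * f) / (m : ℂ) := by
  simp [letterIntegral]

/-- The multiple polylogarithm of a word in the letters. -/
def wordSeries : List (Letter N) → PowerSeries ℂ
  | [] => 1
  | c :: w => letterIntegral c (wordSeries w)

/-- The linear extension of the multiple polylogarithms to `𝒜`. -/
def polylog : A N →ₗ[ℚ] PowerSeries ℂ :=
  (FreeAlgebra.basisFreeMonoid ℚ (Letter N)).constr ℚ fun w => wordSeries (FreeMonoid.toList w)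

theorem polylog_word (w : List (Letter N)) : polylog (word w) = wordSeries w := by
  rw [← basisFreeMonoid_eq_word, polylog, Module.Basis.constr_basis]
  rfl

theorem polylog_ι_mul (c : Letter N) (p : A N) :
    polylog (FreeAlgebra.ι ℚ c * p) = letterIntegral c (polylog p) := by
  have hp := word_mem_span p
  induction hp using Submodule.span_induction with
  | mem p hp =>
    obtain ⟨w, rfl⟩ := hp
    rw [← word_cons, polylog_word, polylog_word, wordSeries]
  | zero => simp
  | add p q _ _ hp hq => rw [mul_add, map_add, map_add, map_add, hp, hq]
  | smul r p _ hp => rw [mul_smul_comm, map_smul, map_smul, map_smul, hp]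

theorem coeff_zero_wordSeries {w : List (Letter N)} (hw : w ≠ []) : coeff 0 (wordSeries w) = 0 := by
  cases w with
  | nil => exact absurd rfl hw
  | cons c w => rw [wordSeries, coeff_letterIntegral, Nat.cast_zero, div_zero]

/-- Integration against dt/t is only meaningful without constant term. A word ending in some y_a
never requires integrating the constant 1 against dt/t. -/
theorem coeff_zero_letterKernel_mul {c : Letter N} {w : List (Letter N)} (h : GoodEnd (c :: w)) :
    coeff 0 (letterKernel c * wordSeries w) = 0 := by
  cases c with
  | x =>
    have hw : w ≠ [] := by
      rintro rfl
      rcases h with h | ⟨u, a, h⟩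
      · simp at h
      · cases u <;> simp at h
    rw [letterKernel, one_mul, coeff_zero_wordSeries hw]
  | y a => simp [letterKernel]

/-- The operator `t d/dt`. -/
def eulerOp (f : PowerSeries ℂ) : PowerSeries ℂ := PowerSeries.X * PowerSeries.derivative ℂ f

theorem coeff_eulerOp (f : PowerSeries ℂ) (m : ℕ) : coeff m (eulerOp f) = m * coeff m f := by
  cases m with
  | zero => simp [eulerOp]
  | succ m =>
    rw [eulerOp, PowerSeries.coeff_succ_X_mul, PowerSeries.coeff_derivative]
    push_cast
    ring

theorem eulerOp_mul (f g : PowerSeries ℂ) : eulerOp (f * g) = eulerOp f * g + f * eulerOp g := by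
  simp only [eulerOp, Derivation.leibniz, smul_eq_mul]
  ring

theorem eulerOp_wordSeries {c : Letter N} {w : List (Letter N)} (h : GoodEnd (c :: w)) :
    eulerOp (wordSeries (c :: w)) = letterKernel c * wordSeries w := by
  ext m
  rw [coeff_eulerOp, wordSeries, coeff_letterIntegral]
  rcases eq_or_ne m 0 with rfl | hm
  · rw [coeff_zero_letterKernel_mul h]
    simp
  · field_simp

/-- The Leibniz rule for t d/dt reproduces the shuffle recursion, which determines all coefficients
except the constant ones; those vanish for nonempty words. -/
theorem polylog_shuffleWord (v w : List (Letter N)) (hv : GoodEnd v) (hw : GoodEnd w) :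
    polylog (shuffleWord v w) = wordSeries v * wordSeries w := by
  induction v, w using shuffleWord.induct with
  | case1 w => rw [shuffleWord, polylog_word, wordSeries, one_mul]
  | case2 c v => rw [shuffleWord, polylog_word, wordSeries.eq_1, mul_one]
  | case3 c v d w ih1 ih2 =>
    rw [shuffleWord, map_add, polylog_ι_mul, polylog_ι_mul, ih1 hv.tail hw, ih2 hv hw.tail]
    have h := eulerOp_mul (wordSeries (c :: v)) (wordSeries (d :: w))
    rw [eulerOp_wordSeries hv, eulerOp_wordSeries hw] at h
    ext m
    have hm := congrArg (coeff m) h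
    rw [coeff_eulerOp, map_add] at hm
    rw [map_add, coeff_letterIntegral, coeff_letterIntegral, ← add_div, ← mul_assoc,
      mul_left_comm, ← hm]
    rcases eq_or_ne m 0 with rfl | hm0
    · have h0 := coeff_zero_wordSeries (List.cons_ne_nil c v)
      rw [PowerSeries.coeff_zero_eq_constantCoeff_apply] at h0
      simp [h0]
    · field_simp

/-! ### Coefficients of multiple polylogarithms -/

theorem coeff_wordSeries_replicate_x (r : ℕ) (u : List (Letter N)) (m : ℕ) :
    coeff m (wordSeries (List.replicate (r + 1) Letter.x ++ u)) =
      coeff m (wordSeries u) / (m : ℂ) ^ (r + 1) := by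
  induction r with
  | zero => simp [wordSeries, coeff_letterIntegral, letterKernel]
  | succ r ih =>
    rw [List.replicate_succ, List.cons_append, wordSeries, coeff_letterIntegral, letterKernel,
      one_mul, ih, div_div, ← pow_succ]

/-- Since ω^{a(m-j)} = ω^{am} ω^{-aj}, the convolution with the kernel becomes a twisted partial
sum. -/
theorem coeff_letterKernel_y_mul [NeZero N] (a : ZMod N) (f : PowerSeries ℂ) (m : ℕ) :
    coeff m (letterKernel (Letter.y a) * f) =
      chi a m * ∑ j ∈ Finset.range m, chi (-a) j * coeff j f := by
  rw [mul_comm, PowerSeries.coeff_mul, Finset.Nat.sum_antidiagonal_eq_sum_range_succ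
    (fun i j => coeff i f * coeff j (letterKernel (Letter.y a))), Finset.sum_range_succ,
    Finset.mul_sum]
  -- The kernel has no constant term, which makes the inequality between successive indices strict.
  have h0 : coeff (m - m) (letterKernel (Letter.y a)) = 0 := by simp [letterKernel]
  rw [h0, mul_zero, add_zero]
  refine Finset.sum_congr rfl fun j hj => ?_
  rw [Finset.mem_range] at hj
  have h1 : chi a m = chi a (m - j) * chi a j := by
    rw [← chi_add_right, Nat.sub_add_cancel hj.le]
  rw [letterKernel, PowerSeries.coeff_mk, if_neg (by omega), h1]
  linear_combination (-(coeff j f * chi a (m - j))) * chi_neg_mul a j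

theorem coeff_wordSeries_letters_cons_eq_sum [NeZero N] (k : ℕ+) (a : ZMod N) (w : ZWord N) (m : ℕ) :
    coeff m (wordSeries (letters ((k, a) :: w))) = chi a m / (m : ℂ) ^ (k : ℕ) *
      ∑ j ∈ Finset.range m, chi (-a) j * coeff j (wordSeries (letters w)) := by
  have hy : coeff m (wordSeries (Letter.y a :: letters w)) = chi a m / (m : ℂ) *
      ∑ j ∈ Finset.range m, chi (-a) j * coeff j (wordSeries (letters w)) := by
    rw [wordSeries, coeff_letterIntegral, coeff_letterKernel_y_mul]
    ring
  obtain ⟨r, hr⟩ : ∃ r, (k : ℕ) = r + 1 := ⟨k - 1, by have := k.pos; omega⟩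
  rw [letters, hr, Nat.add_sub_cancel]
  cases r with
  | zero => simpa using hy
  | succ r =>
    rw [coeff_wordSeries_replicate_x, hy, pow_succ _ (r + 1)]
    ring

/-- This is where ℐ⁻¹ arises: a letter labelled a twists its own index by χ_a and the next one by
χ_{-a}, so nested sums see differences of labels. The range must contain 0, the only index at which
the series of the empty word is nonzero. -/
theorem sum_chi_mul_coeff_wordSeries [NeZero N] (s : ZMod N) (w : ZWord N) {M : ℕ} (hM : 1 ≤ M) :
    ∑ j ∈ Finset.range M, chi (-s) j * coeff j (wordSeries (letters w)) =
      LStarTrunc (differences s w) M := by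
  induction w generalizing s M with
  | nil =>
    rw [letters, wordSeries, differences, LStarTrunc, Finset.sum_eq_single 0]
    · simp [chi_zero_right]
    · intro j _ hj
      simp [PowerSeries.coeff_one, hj]
    · intro h
      simp at h
      omega
  | cons p w ih =>
    obtain ⟨k, a⟩ := p
    rw [differences, LStarTrunc_cons]
    refine Finset.sum_congr rfl fun m _ => ?_
    rw [coeff_wordSeries_letters_cons_eq_sum]
    rcases Nat.eq_zero_or_pos m with rfl | hm
    · simp
    · rw [ih a hm, sub_eq_add_neg, chi_add_left]
      ring

theorem coeff_wordSeries_letters_cons [NeZero N] (k : ℕ+) (a : ZMod N) (w : ZWord N) (m : ℕ) :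
    coeff m (wordSeries (letters ((k, a) :: w))) =
      chi a m / (m : ℂ) ^ (k : ℕ) * LStarTrunc (differences a w) m := by
  rw [coeff_wordSeries_letters_cons_eq_sum]
  rcases Nat.eq_zero_or_pos m with rfl | hm
  · simp
  · rw [sum_chi_mul_coeff_wordSeries a w hm]

theorem truncMap_calI_symm [NeZero N] (p : A1 N) {M : ℕ} (hM : 1 ≤ M) :
    truncMap M (calI.symm p) = ∑ j ∈ Finset.range M, coeff j (polylog (p : A N)) := by
  have h : truncMap M ∘ₗ calI.symm.toLinearMap =
      ∑ j ∈ Finset.range M,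
        ((PowerSeries.coeff (R := ℂ) j).restrictScalars ℚ ∘ₗ polylog) ∘ₗ (A1 N).subtype := by
    refine zBasis.ext fun w => ?_
    have := sum_chi_mul_coeff_wordSeries (0 : ZMod N) w hM
    simp only [neg_zero, chi_zero_left, one_mul] at this
    simp [calI_symm_zBasis, truncMap_zBasis, coe_zBasis, ← word_letters, polylog_word, this]
  have h' := LinearMap.congr_fun h p
  simpa using h'

theorem polylog_shuffleA1 (v w : ZWord N) :
    polylog (shuffleA1 (zBasis v) (zBasis w) : A N) =
      wordSeries (letters v) * wordSeries (letters w) := by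
  rw [shuffleA1]
  dsimp only
  rw [coe_zBasis, coe_zBasis, ← word_letters, ← word_letters, shuffle_word,
    polylog_shuffleWord _ _ (goodEnd_letters v) (goodEnd_letters w)]

/-! ### Estimates -/

theorem one_add_log_nonneg (m : ℕ) : 0 ≤ 1 + Real.log m :=
  add_nonneg zero_le_one (Real.log_natCast_nonneg m)

theorem one_le_one_add_log (m : ℕ) : 1 ≤ 1 + Real.log m :=
  le_add_of_nonneg_right (Real.log_natCast_nonneg m)

theorem sum_range_inv_succ_le (M : ℕ) :
    ∑ m ∈ Finset.range M, ((m : ℝ) + 1)⁻¹ ≤ 1 + Real.log M := by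
  have h := harmonic_le_one_add_log M
  simpa [harmonic] using h

theorem sum_range_inv_le (M : ℕ) : ∑ m ∈ Finset.range M, (m : ℝ)⁻¹ ≤ 1 + Real.log M := by
  refine le_trans ?_ (sum_range_inv_succ_le M)
  cases M with
  | zero => simp
  | succ M =>
    rw [Finset.sum_range_succ', Finset.sum_range_succ]
    simp only [Nat.cast_add, Nat.cast_one, CharP.cast_eq_zero, inv_zero]
    gcongr
    positivity

theorem norm_LStarTrunc_le [NeZero N] (w : ZWord N) (M : ℕ) :
    ‖LStarTrunc w M‖ ≤ (1 + Real.log M) ^ w.length := by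
  induction w generalizing M with
  | nil => simp [LStarTrunc]
  | cons p w ih =>
    obtain ⟨k, a⟩ := p
    rw [LStarTrunc_cons, List.length_cons, pow_succ]
    calc ‖∑ m ∈ Finset.range M, chi a m / (m : ℂ) ^ (k : ℕ) * LStarTrunc w m‖
        ≤ ∑ m ∈ Finset.range M, (1 + Real.log M) ^ w.length * (m : ℝ)⁻¹ := by
          refine norm_sum_le_of_le _ fun m hm => ?_
          rw [Finset.mem_range] at hm
          rcases Nat.eq_zero_or_pos m with rfl | hm0
          · simp
          have hm1 : (1 : ℝ) ≤ m := by exact_mod_cast hm0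
          rw [norm_mul, norm_div, norm_chi, norm_pow, Complex.norm_natCast, mul_comm, one_div]
          refine mul_le_mul ((ih m).trans ?_) ?_ (by positivity)
            (pow_nonneg (one_add_log_nonneg M) _)
          · refine pow_le_pow_left₀ (one_add_log_nonneg m) ?_ _
            gcongr
          · refine inv_anti₀ (by linarith) ?_
            exact le_self_pow₀ hm1 k.pos.ne'
      _ = (1 + Real.log M) ^ w.length * ∑ m ∈ Finset.range M, (m : ℝ)⁻¹ := by
          rw [Finset.mul_sum]
      _ ≤ _ := mul_le_mul_of_nonneg_left (sum_range_inv_le M)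
          (pow_nonneg (one_add_log_nonneg M) _)

theorem exists_one_add_log_pow_le (n : ℕ) :
    ∃ C : ℝ, 0 ≤ C ∧ ∀ m : ℕ, 1 ≤ m → (1 + Real.log m) ^ n ≤ C * (m : ℝ) ^ (1 / 2 : ℝ) := by
  -- Chosen so that ε n ≤ 1/2; the + 1 keeps ε defined for n = 0.
  set ε : ℝ := 1 / (2 * (n + 1)) with hε
  have hε0 : 0 < ε := by positivity
  refine ⟨(1 + 1 / ε) ^ n, by positivity, fun m hm => ?_⟩
  have hm1 : (1 : ℝ) ≤ m := by exact_mod_cast hm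
  have h1 : 1 + Real.log m ≤ (1 + 1 / ε) * (m : ℝ) ^ ε := by
    have := Real.log_le_rpow_div (x := (m : ℝ)) (by linarith) hε0
    have h2 : 1 ≤ (m : ℝ) ^ ε := Real.one_le_rpow hm1 hε0.le
    rw [add_mul, one_mul, one_div_mul_eq_div]
    linarith
  calc (1 + Real.log m) ^ n ≤ ((1 + 1 / ε) * (m : ℝ) ^ ε) ^ n :=
        pow_le_pow_left₀ (one_add_log_nonneg m) h1 _
    _ = (1 + 1 / ε) ^ n * (m : ℝ) ^ (ε * n) := by
        rw [mul_pow, Real.rpow_mul (by linarith), Real.rpow_natCast]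
    _ ≤ _ := by
        refine mul_le_mul_of_nonneg_left (Real.rpow_le_rpow_of_exponent_le hm1 ?_) (by positivity)
        rw [hε, one_div_mul_eq_div, div_le_div_iff₀ (by positivity) (by positivity)]
        nlinarith

theorem summable_one_add_log_pow_div_sq (n : ℕ) :
    Summable fun m : ℕ => (1 + Real.log m) ^ n / (m : ℝ) ^ 2 := by
  obtain ⟨C, hC, h⟩ := exists_one_add_log_pow_le n
  have hs : Summable fun m : ℕ => C * (1 / (m : ℝ) ^ (3 / 2 : ℝ)) :=
    (Real.summable_one_div_nat_rpow.2 (by norm_num)).mul_left C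
  refine Summable.of_nonneg_of_le
    (fun m => div_nonneg (pow_nonneg (one_add_log_nonneg m) _) (by positivity)) (fun m => ?_) hs
  rcases Nat.eq_zero_or_pos m with rfl | hm
  · simp
  have hm0 : (0 : ℝ) < m := by exact_mod_cast hm
  have e : (m : ℝ) ^ 2 = (m : ℝ) ^ (1 / 2 : ℝ) * (m : ℝ) ^ (3 / 2 : ℝ) := by
    rw [← Real.rpow_add hm0, ← Real.rpow_natCast]
    norm_num
  rw [e, div_le_iff₀ (by positivity)]
  have h3 : 0 < (m : ℝ) ^ (3 / 2 : ℝ) := by positivity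
  calc (1 + Real.log m) ^ n ≤ C * (m : ℝ) ^ (1 / 2 : ℝ) := h m hm
    _ = _ := by field_simp

theorem tendsto_one_add_log_pow_div (n : ℕ) :
    Filter.Tendsto (fun m : ℕ => (1 + Real.log m) ^ n / (m : ℝ)) Filter.atTop (nhds 0) := by
  obtain ⟨C, hC, h⟩ := exists_one_add_log_pow_le n
  have hs : Filter.Tendsto (fun m : ℕ => C * (m : ℝ) ^ (-(1 / 2 : ℝ))) Filter.atTop (nhds 0) := by
    have := ((tendsto_rpow_neg_atTop (y := (1 / 2 : ℝ)) (by norm_num)).comp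
      tendsto_natCast_atTop_atTop).const_mul C
    simpa using this
  refine squeeze_zero' (Filter.Eventually.of_forall fun m =>
    div_nonneg (pow_nonneg (one_add_log_nonneg m) _) (by positivity)) ?_ hs
  filter_upwards [Filter.eventually_ge_atTop 1] with m hm
  have hm0 : (0 : ℝ) < m := by exact_mod_cast hm
  rw [div_le_iff₀ hm0, mul_assoc]
  have e : (m : ℝ) ^ (-(1 / 2 : ℝ)) * m = (m : ℝ) ^ (1 / 2 : ℝ) := by
    nth_rewrite 2 [← Real.rpow_one (m : ℝ)]
    rw [← Real.rpow_add hm0]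
    norm_num
  rw [e]
  exact h m hm

/-! ### Convergence of the series -/

theorem norm_chi_div_pow_mul_le [NeZero N] {k : ℕ+} (hk : 2 ≤ k) (a : ZMod N) (w : ZWord N)
    (m : ℕ) : ‖chi a m / (m : ℂ) ^ (k : ℕ) * LStarTrunc w m‖ ≤
      (1 + Real.log m) ^ w.length / (m : ℝ) ^ 2 := by
  rcases Nat.eq_zero_or_pos m with rfl | hm
  · simp
  have hm1 : (1 : ℝ) ≤ m := by exact_mod_cast hm
  have hk' : 2 ≤ (k : ℕ) := by exact_mod_cast hk
  rw [norm_mul, norm_div, norm_chi, norm_pow, Complex.norm_natCast, mul_comm, one_div,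
    ← div_eq_mul_inv]
  exact div_le_div₀ (pow_nonneg (one_add_log_nonneg m) _) (norm_LStarTrunc_le w m) (by positivity)
    (pow_le_pow_right₀ hm1 hk')

theorem summable_of_two_le [NeZero N] {k : ℕ+} (hk : 2 ≤ k) (a : ZMod N) (w : ZWord N) :
    Summable fun m : ℕ => chi a m / (m : ℂ) ^ (k : ℕ) * LStarTrunc w m :=
  Summable.of_norm_bounded (summable_one_add_log_pow_div_sq w.length)
    (norm_chi_div_pow_mul_le hk a w)

theorem norm_sum_chi_le [NeZero N] {b : ZMod N} (hb : b ≠ 0) (M : ℕ) :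
    ‖∑ m ∈ Finset.range M, chi b m‖ ≤ 2 / ‖chi b 1 - 1‖ := by
  have h : ∀ m, chi b m = chi b 1 ^ m := fun m => by simp [chi, pow_mul]
  rw [Finset.sum_congr rfl fun m _ => h m, geom_sum_eq (chi_one_ne_one hb), norm_div]
  gcongr
  calc ‖chi b 1 ^ M - 1‖ ≤ ‖chi b 1 ^ M‖ + ‖(1 : ℂ)‖ := norm_sub_le _ _
    _ = 2 := by
      rw [norm_pow, norm_chi]
      norm_num

theorem norm_LStarTrunc_succ_sub_le [NeZero N] (w : ZWord N) {m : ℕ} (hm : 1 ≤ m) :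
    ‖LStarTrunc w (m + 1) - LStarTrunc w m‖ ≤ (1 + Real.log m) ^ w.length / m := by
  have hm1 : (1 : ℝ) ≤ m := by exact_mod_cast hm
  cases w with
  | nil =>
    simp [LStarTrunc]
  | cons p w =>
    obtain ⟨k, a⟩ := p
    rw [LStarTrunc_cons_succ, add_sub_cancel_left, norm_mul, norm_div, norm_chi, norm_pow,
      Complex.norm_natCast, mul_comm, one_div, ← div_eq_mul_inv]
    refine div_le_div₀ (pow_nonneg (one_add_log_nonneg m) _) ((norm_LStarTrunc_le w m).trans ?_)
      (by positivity) (le_self_pow₀ hm1 k.pos.ne')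
    exact pow_le_pow_right₀ (one_le_one_add_log m) (by simp)

/-- The bounded variation needed for Abel summation: both the increment of the truncation and that
of 1/m contribute at most a power of 1 + log m divided by m². -/
theorem summable_norm_sub_LStarTrunc_div [NeZero N] (w : ZWord N) :
    Summable fun m : ℕ =>
      ‖LStarTrunc w (m + 1) / ((m + 1 : ℕ) : ℂ) - LStarTrunc w m / (m : ℂ)‖ := by
  rw [← summable_nat_add_iff 1]
  have hs : Summable fun m : ℕ => 2 * ((1 + Real.log m) ^ w.length / (m : ℝ) ^ 2) :=
    (summable_one_add_log_pow_div_sq w.length).mul_left 2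
  rw [← summable_nat_add_iff 1] at hs
  refine Summable.of_nonneg_of_le (fun _ => norm_nonneg _) (fun i => ?_) hs
  generalize hm : i + 1 = m
  have hm1 : 1 ≤ m := by omega
  have hm0 : (0 : ℝ) < m := by exact_mod_cast hm1
  have hmC : (m : ℂ) ≠ 0 := by exact_mod_cast hm0.ne'
  have hmC' : (m : ℂ) + 1 ≠ 0 := by exact_mod_cast (Nat.succ_ne_zero m)
  set P : ℝ := (1 + Real.log m) ^ w.length with hP
  have hP0 : 0 ≤ P := pow_nonneg (one_add_log_nonneg m) _
  have e : LStarTrunc w (m + 1) / ((m + 1 : ℕ) : ℂ) - LStarTrunc w m / (m : ℂ) =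
      (LStarTrunc w (m + 1) - LStarTrunc w m) / ((m + 1 : ℕ) : ℂ) -
        LStarTrunc w m / ((m : ℂ) * ((m + 1 : ℕ) : ℂ)) := by
    push_cast
    field_simp
    ring
  rw [e]
  calc _ ≤ ‖(LStarTrunc w (m + 1) - LStarTrunc w m) / ((m + 1 : ℕ) : ℂ)‖ +
        ‖LStarTrunc w m / ((m : ℂ) * ((m + 1 : ℕ) : ℂ))‖ := norm_sub_le _ _
    _ ≤ P / m / m + P / (m * m) := by
      rw [norm_div, norm_div, norm_mul, Complex.norm_natCast, Complex.norm_natCast]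
      have hle : (m : ℝ) ≤ ((m + 1 : ℕ) : ℝ) := by push_cast; linarith
      gcongr
      · exact norm_LStarTrunc_succ_sub_le w hm1
      · exact norm_LStarTrunc_le w m
    _ = 2 * (P / (m : ℝ) ^ 2) := by
      field_simp
      ring

/-- Abel summation: the partial sums of χ_b are bounded because b ≠ 0, while the remaining factor
tends to 0 and has bounded variation. -/
theorem exists_tendsto_LStarTrunc_one [NeZero N] {b : ZMod N} (hb : b ≠ 0) (w : ZWord N) :
    ∃ l, Filter.Tendsto (LStarTrunc ((1, b) :: w)) Filter.atTop (nhds l) := by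
  set f : ℕ → ℂ := fun m => LStarTrunc w m / (m : ℂ) with hf
  set G : ℕ → ℂ := fun M => ∑ m ∈ Finset.range M, chi b m with hG
  set K : ℝ := 2 / ‖chi b 1 - 1‖ with hK
  have hsum : Summable fun m : ℕ => (f (m + 1) - f m) • G (m + 1) := by
    refine Summable.of_norm_bounded ((summable_norm_sub_LStarTrunc_div w).mul_right K) fun m => ?_
    rw [norm_smul]
    exact mul_le_mul_of_nonneg_left (norm_sum_chi_le hb _) (norm_nonneg _)
  have hf0 : Filter.Tendsto f Filter.atTop (nhds 0) := by
    refine squeeze_zero_norm (fun m => ?_) (tendsto_one_add_log_pow_div w.length)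
    rw [hf, norm_div, Complex.norm_natCast]
    gcongr
    exact norm_LStarTrunc_le w m
  have hfG : Filter.Tendsto (fun M => f M • G (M + 1)) Filter.atTop (nhds 0) := by
    have h0 : Filter.Tendsto (fun M => ‖f M‖ * K) Filter.atTop (nhds 0) := by
      simpa using hf0.norm.mul_const K
    refine squeeze_zero_norm (fun M => ?_) h0
    rw [norm_smul]
    exact mul_le_mul_of_nonneg_left (norm_sum_chi_le hb _) (norm_nonneg _)
  refine ⟨_, (Filter.tendsto_add_atTop_iff_nat 1).1 ((hfG.sub hsum.hasSum.tendsto_sum_nat).congr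
    fun M => ?_)⟩
  have h := Finset.sum_range_by_parts f (fun m => chi b m) (M + 1)
  rw [Nat.add_sub_cancel] at h
  rw [← h, LStarTrunc_cons]
  refine Finset.sum_congr rfl fun m _ => ?_
  rw [hf, smul_eq_mul, PNat.one_coe, pow_one]
  ring

theorem tendsto_LStarTrunc [NeZero N] (j : ℕ+) (b : ZMod N) (w : ZWord N) (h : 2 ≤ j ∨ b ≠ 0) :
    Filter.Tendsto (LStarTrunc ((j, b) :: w)) Filter.atTop (nhds (LStarValue ((j, b) :: w))) := by
  refine tendsto_nhds_limUnder ?_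
  by_cases hj : 2 ≤ j
  · refine ⟨_, (summable_of_two_le hj b w).hasSum.tendsto_sum_nat.congr fun M => ?_⟩
    rw [LStarTrunc_cons]
  · have hj1 : j = 1 := by
      refine le_antisymm ?_ one_le
      rw [not_le] at hj
      exact PNat.lt_add_one_iff.1 hj
    subst hj1
    exact exists_tendsto_LStarTrunc_one (h.resolve_left hj) w

/-! ### Comparison of the Cauchy product with the product of partial sums -/

theorem sum_Ico_sub_inv_le {M j : ℕ} (hj : j < M) :
    ∑ i ∈ Finset.Ico (M - j) M, (i : ℝ)⁻¹ ≤ 1 + Real.log j := by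
  rw [Finset.sum_Ico_eq_sum_range, Nat.sub_sub_self hj.le]
  refine le_trans (Finset.sum_le_sum fun i _ => ?_) (sum_range_inv_succ_le j)
  refine inv_anti₀ (by positivity) ?_
  have : i + 1 ≤ M - j + i := by omega
  exact_mod_cast this

/-- The square i, j < M exceeds the triangle i + j < M by ∑_j g_j ∑_{M-j≤i<M} f_i. The inner sum
tends to 0 for fixed j and is at most 1 + log j in norm, so dominated convergence applies, and ∑ f_i
itself need not converge. -/
theorem tendsto_sum_cauchyProduct_sub {f g : ℕ → ℂ} (hf : ∀ i, ‖f i‖ ≤ (i : ℝ)⁻¹)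
    (hg : Summable fun j : ℕ => ‖g j‖ * (1 + Real.log j)) :
    Filter.Tendsto (fun M => ∑ m ∈ Finset.range M, ∑ p ∈ antidiagonal m, f p.1 * g p.2 -
      (∑ i ∈ Finset.range M, f i) * ∑ j ∈ Finset.range M, g j) Filter.atTop (nhds 0) := by
  set D : ℕ → ℕ → ℂ := fun M j => if j < M then g j * ∑ i ∈ Finset.Ico (M - j) M, f i else 0
    with hD
  have hnorm : ∀ M j, j < M → ‖D M j‖ ≤ ‖g j‖ * ∑ i ∈ Finset.Ico (M - j) M, (i : ℝ)⁻¹ := by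
    intro M j hj
    rw [hD]
    dsimp only
    rw [if_pos hj, norm_mul]
    exact mul_le_mul_of_nonneg_left (norm_sum_le_of_le _ fun i _ => hf i) (norm_nonneg _)
  have hlim : Filter.Tendsto (fun M => ∑' j, D M j) Filter.atTop (nhds (∑' _ : ℕ, (0 : ℂ))) := by
    refine tendsto_tsum_of_dominated_convergence hg (fun j => ?_)
      (Filter.Eventually.of_forall fun M j => ?_)
    -- For fixed j the inner sum has j terms, each at most 1/(M - j).
    · have h0 : Filter.Tendsto (fun M : ℕ => ‖g j‖ * (j * ((M - j : ℕ) : ℝ)⁻¹)) Filter.atTop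
          (nhds 0) := by
        have : Filter.Tendsto (fun M : ℕ => ((M - j : ℕ) : ℝ)⁻¹) Filter.atTop (nhds 0) :=
          tendsto_inv_atTop_nhds_zero_nat.comp (Filter.tendsto_sub_atTop_nat j)
        simpa using (this.const_mul (j : ℝ)).const_mul ‖g j‖
      refine squeeze_zero_norm' ?_ h0
      filter_upwards [Filter.eventually_gt_atTop j] with M hM
      refine (hnorm M j hM).trans (mul_le_mul_of_nonneg_left ?_ (norm_nonneg _))
      have hc : (Finset.Ico (M - j) M).card = j := by
        rw [Nat.card_Ico]
        omega
      calc ∑ i ∈ Finset.Ico (M - j) M, (i : ℝ)⁻¹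
          ≤ ∑ i ∈ Finset.Ico (M - j) M, ((M - j : ℕ) : ℝ)⁻¹ := by
            refine Finset.sum_le_sum fun i hi => ?_
            rw [Finset.mem_Ico] at hi
            refine inv_anti₀ ?_ (by exact_mod_cast hi.1)
            have : 0 < M - j := by omega
            exact_mod_cast this
        _ = _ := by rw [Finset.sum_const, hc, nsmul_eq_mul]
    · by_cases hj : j < M
      · exact (hnorm M j hj).trans (mul_le_mul_of_nonneg_left (sum_Ico_sub_inv_le hj)
          (norm_nonneg _))
      · rw [hD]
        dsimp only
        rw [if_neg hj, norm_zero]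
        exact mul_nonneg (norm_nonneg _) (one_add_log_nonneg j)
  rw [tsum_zero] at hlim
  have hneg := hlim.neg
  rw [neg_zero] at hneg
  refine hneg.congr fun M => ?_
  have h1 : ∑' j, D M j = ∑ j ∈ Finset.range M, D M j := by
    refine tsum_eq_sum fun j hj => ?_
    rw [Finset.mem_range] at hj
    exact if_neg hj
  have h2 : ∑ m ∈ Finset.range M, ∑ p ∈ antidiagonal m, f p.1 * g p.2 =
      ∑ j ∈ Finset.range M, ∑ i ∈ Finset.range (M - j), f i * g j := by
    rw [← Finset.sum_range_diag_flip M (fun j i => f i * g j)]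
    refine Finset.sum_congr rfl fun m _ => ?_
    rw [← Finset.Nat.sum_antidiagonal_swap]
    exact Finset.Nat.sum_antidiagonal_eq_sum_range_succ (fun j i => f i * g j) m
  rw [h1, h2, Finset.mul_sum, ← Finset.sum_sub_distrib, ← Finset.sum_neg_distrib]
  refine Finset.sum_congr rfl fun j hj => ?_
  rw [Finset.mem_range] at hj
  have h3 := Finset.sum_range_add_sum_Ico f (Nat.sub_le M j)
  rw [← h3, ← Finset.sum_mul, hD]
  dsimp only
  rw [if_pos hj]
  ring

/-! ### Double shuffle relations -/

/-- Includes the divergent case l = 1, a = 0: only the difference of the two products has to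
converge. -/
theorem tendsto_truncMap_doubleShuffle [NeZero N] (l k : ℕ+) (hk : 2 ≤ k) (a b : ZMod N)
    (w : ZWord N) :
    Filter.Tendsto (fun M => truncMap M
      (calI.symm (shuffleA1 (zBasis [(l, a)]) (zBasis ((k, b) :: w))) -
        harmonicProd (calI.symm (zBasis [(l, a)])) (calI.symm (zBasis ((k, b) :: w)))))
      Filter.atTop (nhds 0) := by
  set f : ℕ → ℂ := fun i => coeff i (wordSeries (letters [(l, a)])) with hf
  set g : ℕ → ℂ := fun j => coeff j (wordSeries (letters ((k, b) :: w))) with hg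
  have hfb : ∀ i, ‖f i‖ ≤ (i : ℝ)⁻¹ := fun i => by
    rw [hf]
    dsimp only
    rw [coeff_wordSeries_letters_cons, differences, LStarTrunc, mul_one, norm_div, norm_chi,
      norm_pow, Complex.norm_natCast, one_div]
    rcases Nat.eq_zero_or_pos i with rfl | hi
    · simp
    · have hi1 : (1 : ℝ) ≤ i := by exact_mod_cast hi
      exact inv_anti₀ (by linarith) (le_self_pow₀ hi1 l.pos.ne')
  -- The extra logarithm only raises the power of 1 + log j, which 1/j² still dominates; this uses k
  -- ≥ 2.
  have hgs : Summable fun j : ℕ => ‖g j‖ * (1 + Real.log j) := by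
    refine Summable.of_nonneg_of_le
      (fun j => mul_nonneg (norm_nonneg _) (one_add_log_nonneg j)) (fun j => ?_)
      (summable_one_add_log_pow_div_sq ((differences b w).length + 1))
    rw [pow_succ, mul_div_right_comm]
    refine mul_le_mul_of_nonneg_right ?_ (one_add_log_nonneg j)
    rw [hg]
    dsimp only
    rw [coeff_wordSeries_letters_cons]
    exact norm_chi_div_pow_mul_le hk b _ j
  refine (tendsto_sum_cauchyProduct_sub hfb hgs).congr' ?_
  filter_upwards [Filter.eventually_ge_atTop 1] with M hM
  rw [map_sub, truncMap_harmonicProd, truncMap_calI_symm _ hM, truncMap_calI_symm _ hM,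
    truncMap_calI_symm _ hM, polylog_shuffleA1, coe_zBasis, coe_zBasis, ← word_letters,
    ← word_letters, polylog_word, polylog_word]
  simp only [PowerSeries.coeff_mul, hf, hg]

/-! ### The evaluation map as a limit -/

variable (N) in
/-- The elements of `𝒜¹` on which the truncated evaluations converge to the evaluation of the
words. -/
def convergent : Submodule ℚ (A1 N) where
  carrier := {p | Filter.Tendsto (fun M => truncMap M p) Filter.atTop
    (nhds (zBasis.constr ℚ LStarValue p))}
  zero_mem' := by simp
  add_mem' hp hq := by
    simp only [Set.mem_ofPred_eq, map_add] at hp hq ⊢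
    exact hp.add hq
  smul_mem' r p hp := by
    simp only [Set.mem_ofPred_eq, map_smul] at hp ⊢
    exact hp.const_smul r

theorem mem_convergent {p : A1 N} : p ∈ convergent N ↔
    Filter.Tendsto (fun M => truncMap M p) Filter.atTop
      (nhds (zBasis.constr ℚ LStarValue p)) := Iff.rfl

theorem zBasis_cons_mem_convergent [NeZero N] {j : ℕ+} {b : ZMod N} (w : ZWord N)
    (h : 2 ≤ j ∨ b ≠ 0) : zBasis ((j, b) :: w) ∈ convergent N := by
  rw [mem_convergent, Module.Basis.constr_basis]
  simp only [truncMap_zBasis]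
  exact tendsto_LStarTrunc j b w h

/-- A first letter other than y_0 means that the first block has k ≥ 2 or a nonzero label. -/
theorem word_mem_map_convergent [NeZero N] {c : Letter N} (hc : c ≠ Letter.y 0)
    (v : List (Letter N)) (a : ZMod N) :
    word (c :: v ++ [Letter.y a]) ∈ (convergent N).map (A1 N).subtype := by
  obtain ⟨w, hw, h⟩ := exists_letters (c :: v) a
  match w, hw with
  | (k, b) :: w, _ =>
    refine ⟨zBasis ((k, b) :: w), zBasis_cons_mem_convergent w ?_, ?_⟩
    · by_contra hcon
      push Not at hcon
      obtain ⟨hk, rfl⟩ := hcon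
      have hk' : (k : ℕ) - 1 = 0 := by
        have : (k : ℕ) < 2 := by exact_mod_cast hk
        omega
      rw [letters, hk', List.replicate_zero, List.nil_append, List.cons_append,
        List.cons.injEq] at h
      exact hc h.1.symm
    · rw [Submodule.subtype_apply, coe_zBasis, ← word_letters, h]

theorem ι_mul_mul_Y_mem_map_convergent [NeZero N] {c : Letter N} (hc : c ≠ Letter.y 0)
    (u : A N) (a : ZMod N) :
    FreeAlgebra.ι ℚ c * u * Y a ∈ (convergent N).map (A1 N).subtype := by
  have hu := word_mem_span u
  induction hu using Submodule.span_induction with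
  | mem q hq =>
    obtain ⟨v, rfl⟩ := hq
    have h := word_mem_map_convergent hc v a
    rwa [show word (c :: v ++ [Letter.y a]) = FreeAlgebra.ι ℚ c * word v * Y a by
      simp [word, Y, mul_assoc]] at h
  | zero => simp
  | add p q _ _ hp hq =>
    rw [mul_add, add_mul]
    exact add_mem hp hq
  | smul r p _ hp =>
    rw [mul_smul_comm, smul_mul_assoc]
    exact Submodule.smul_mem _ r hp

theorem A0_le_map_convergent [NeZero N] : A0 N ≤ (convergent N).map (A1 N).subtype := by
  refine Submodule.span_le.2 ?_
  rintro p ((hp | ⟨u, a, rfl⟩) | ⟨u, a, b, hb, rfl⟩)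
  · rw [Set.mem_singleton_iff] at hp
    subst hp
    refine ⟨zBasis [], ?_, by rw [Submodule.subtype_apply, coe_zBasis]; rfl⟩
    rw [SetLike.mem_coe, mem_convergent, Module.Basis.constr_basis]
    simp only [truncMap_zBasis]
    refine tendsto_nhds_limUnder ⟨1, ?_⟩
    simp only [show LStarTrunc ([] : ZWord N) = fun _ => 1 from funext fun _ => by rw [LStarTrunc]]
    exact tendsto_const_nhds
  · exact ι_mul_mul_Y_mem_map_convergent (by simp) u a
  · exact ι_mul_mul_Y_mem_map_convergent (by simpa using hb) u a

theorem tendsto_truncMap_LStar [NeZero N] (p : A0 N) :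
    Filter.Tendsto (fun M => truncMap M (Submodule.inclusion A0_le_A1 p)) Filter.atTop
      (nhds (LStar p)) := by
  obtain ⟨q, hq, hqp⟩ := A0_le_map_convergent p.2
  have : q = Submodule.inclusion A0_le_A1 p := Subtype.ext hqp
  subst this
  exact hq

/-! ### The weighted sum belongs to `𝒜⁰` -/

theorem X_mul_mem_A0 {p : A N} (hp : p ∈ A1pos N) : X * p ∈ A0 N := by
  induction hp using Submodule.span_induction with
  | mem p hp =>
    obtain ⟨u, a, rfl⟩ := hp
    exact Submodule.subset_span (Or.inl (Or.inr ⟨u, a, by rw [mul_assoc]⟩))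
  | zero => simp
  | add p p' _ _ hp hp' =>
    rw [mul_add]
    exact add_mem hp hp'
  | smul c p _ hp =>
    rw [mul_smul_comm]
    exact Submodule.smul_mem _ c hp

theorem Y_mul_mem_A0 {b : ZMod N} (hb : b ≠ 0) {p : A N} (hp : p ∈ A1pos N) :
    Y b * p ∈ A0 N := by
  induction hp using Submodule.span_induction with
  | mem p hp =>
    obtain ⟨u, a, rfl⟩ := hp
    exact Submodule.subset_span (Or.inr ⟨u, a, b, hb, by rw [mul_assoc]⟩)
  | zero => simp
  | add p p' _ _ hp hp' =>
    rw [mul_add]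
    exact add_mem hp hp'
  | smul c p _ hp =>
    rw [mul_smul_comm]
    exact Submodule.smul_mem _ c hp

theorem zProd_mem_A1pos (m : ℕ) (κ : ℕ → ℕ) (c : ℕ → ZMod N) : zProd (m + 1) κ c ∈ A1pos N := by
  refine Submodule.subset_span ⟨zProd m κ c * X ^ (κ (m + 1) - 1), c (m + 1), ?_⟩
  simp [zProd, List.range_succ, z, mul_assoc]

theorem zProd_mem_A0_of_two_le (m : ℕ) {κ : ℕ → ℕ} (c : ℕ → ZMod N) (h : 2 ≤ κ 1) :
    zProd (m + 1) κ c ∈ A0 N := by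
  have e : zProd (m + 1) κ c = X * zProd (m + 1) (Function.update κ 1 (κ 1 - 1)) c := by
    obtain ⟨r, hr⟩ : ∃ r, κ 1 = r + 1 := ⟨κ 1 - 1, by omega⟩
    rw [zProd_succ, zProd_succ, Function.update_self, hr, Nat.add_sub_cancel,
      z_succ (by omega), mul_assoc]
    congr 2
  rw [e]
  exact X_mul_mem_A0 (zProd_mem_A1pos m _ c)

theorem zProd_mem_A0_of_ne_zero (m : ℕ) {κ : ℕ → ℕ} {c : ℕ → ZMod N} (h : κ 1 = 1)
    (hc : c 1 ≠ 0) : zProd (m + 2) κ c ∈ A0 N := by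
  rw [zProd_succ, h, z_one]
  exact Y_mul_mem_A0 hc (zProd_mem_A1pos m _ _)

theorem frontDiffLabel_zero (α : ℕ → ZMod N) {j : ℕ} (hj : 1 ≤ j) :
    frontDiffLabel 0 α j = insertLabel 0 α 0 j := by
  obtain rfl | rfl | h : j = 1 ∨ j = 2 ∨ 3 ≤ j := by omega
  · simp [frontDiffLabel, insertLabel]
  · simp [frontDiffLabel, insertLabel, diffLabel]
  · rw [frontDiffLabel, insertLabel, if_neg (by omega), if_neg (by omega), if_neg (by omega),
      if_neg (by omega)]

/-- Only the first and fifth sums contain words with κ_1 = 1, and these start with y_a. For a ≠ 0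
they are admissible. For a = 0 the labels in the two sums coincide and both coefficients are 1, so
the words cancel. -/
theorem weightedSum_mem_A0 (n k : ℕ) (hn : 2 ≤ n) (a : ZMod N) (α : ℕ → ZMod N) :
    weightedSum n k a α ∈ A0 N := by
  obtain ⟨m, rfl⟩ := Nat.exists_eq_add_of_le' hn
  have hfront : (∑ κ ∈ comps (Finset.Icc 1 (m + 2)) k with 2 ≤ κ 2,
        (2 : ℚ) ^ (κ 1 - 1) • zProd (m + 2) κ (frontDiffLabel a α)) -
      (∑ κ ∈ comps (Finset.Icc 1 (m + 2)) k with 2 ≤ κ 2,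
        zProd (m + 2) κ (insertLabel a α 0)) ∈ A0 N := by
    rw [← Finset.sum_sub_distrib]
    refine sum_mem fun κ hκ => ?_
    have h1 : 1 ≤ κ 1 := (mem_comps.1 (Finset.mem_filter.1 hκ).1).2 1 (by simp)
    by_cases h2 : 2 ≤ κ 1
    · exact sub_mem (Submodule.smul_mem _ _ (zProd_mem_A0_of_two_le _ _ h2))
        (zProd_mem_A0_of_two_le _ _ h2)
    have h3 : κ 1 = 1 := by omega
    by_cases ha : a = 0
    · subst ha
      rw [h3, zProd_congr (κ := κ) (fun _ _ _ => rfl)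
        fun j hj _ => frontDiffLabel_zero α hj]
      simp
    · exact sub_mem (Submodule.smul_mem _ _ (zProd_mem_A0_of_ne_zero _ h3 (by
        simpa [frontDiffLabel] using ha))) (zProd_mem_A0_of_ne_zero _ h3 (by
        simpa [insertLabel] using ha))
  have hrest : ∀ (m' : ℕ) (f : (ℕ → ℕ) → ℚ) (c : ℕ → ZMod N) (s : Finset (ℕ → ℕ)),
      ∑ κ ∈ s with 2 ≤ κ 1, f κ • zProd (m' + 1) κ c ∈ A0 N := fun m' f c s =>
    sum_mem fun κ hκ =>
      Submodule.smul_mem _ _ (zProd_mem_A0_of_two_le _ _ (Finset.mem_filter.1 hκ).2)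
  have hsecond : (∑ κ ∈ comps (Finset.Icc 1 (m + 2)) k with 2 ≤ κ 1 ∧ κ 2 = 1,
      ((2 : ℚ) ^ (κ 1 - 1) - 1) • zProd (m + 2) κ (frontDiffLabel a α)) ∈ A0 N :=
    sum_mem fun κ hκ =>
      Submodule.smul_mem _ _ (zProd_mem_A0_of_two_le _ _ (Finset.mem_filter.1 hκ).2.1)
  have hinsert : (∑ i ∈ Finset.Icc 1 (m + 2 - 1),
      ∑ κ ∈ comps (Finset.Icc 1 (m + 2)) k with 2 ≤ κ 1,
        zProd (m + 2) κ (insertLabel a α i)) ∈ A0 N :=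
    sum_mem fun i _ => sum_mem fun κ hκ => zProd_mem_A0_of_two_le _ _ (Finset.mem_filter.1 hκ).2
  have hpair : ∀ S₁ S₂ S₃ S₄ S₅ S₆ S₇ S₈ : A N, S₁ + S₂ + S₃ + S₄ - S₅ - S₆ - S₇ - S₈ =
      (S₁ - S₅) + S₂ + S₃ + S₄ - S₆ - S₇ - S₈ := fun _ _ _ _ _ _ _ _ => by abel
  rw [weightedSum, hpair]
  exact sub_mem (sub_mem (sub_mem (add_mem (add_mem (add_mem hfront hsecond)
    (sum_mem fun i _ => hrest _ _ _ _)) (hrest _ _ _ _)) hinsert) (hrest _ _ _ _))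
    (sum_mem fun i _ => hrest _ _ _ _)

/-! ### The main theorem -/

theorem LStar_weightedSum [NeZero N] (n k : ℕ) (hn : 2 ≤ n) (a : ZMod N) (α : ℕ → ZMod N)
    (h : weightedSum n k a α ∈ A0 N) : LStar ⟨weightedSum n k a α, h⟩ = 0 := by
  refine tendsto_nhds_unique (tendsto_truncMap_LStar _) ?_
  have e : Submodule.inclusion A0_le_A1 ⟨weightedSum n k a α, h⟩ =
      ∑ κ ∈ comps (Finset.Icc 0 (n - 1)) k with 2 ≤ κ 1,
        (calI.symm (shuffleA1 (z1 (κ 0) a) (zProd1 (n - 1) κ α)) -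
          harmonicProd (calI.symm (z1 (κ 0) a)) (calI.symm (zProd1 (n - 1) κ α))) :=
    -- The algebraic identity, read in 𝒜¹, allows the limit to be taken termwise over double shuffle
    -- relations.
    Subtype.ext (sum_doubleShuffle_eq_weightedSum n k hn a α).symm
  have hterm : ∀ κ ∈ {κ ∈ comps (Finset.Icc 0 (n - 1)) k | 2 ≤ κ 1},
      Filter.Tendsto (fun M => truncMap M
        (calI.symm (shuffleA1 (z1 (κ 0) a) (zProd1 (n - 1) κ α)) -
          harmonicProd (calI.symm (z1 (κ 0) a)) (calI.symm (zProd1 (n - 1) κ α))))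
        Filter.atTop (nhds 0) := by
    intro κ hκ
    obtain ⟨hκ, hκ1⟩ := Finset.mem_filter.1 hκ
    obtain ⟨l, hl⟩ : ∃ l : ℕ+, (l : ℕ) = κ 0 := ⟨⟨κ 0, (mem_comps.1 hκ).2 0 (by simp)⟩, rfl⟩
    obtain ⟨m, rfl⟩ := Nat.exists_eq_add_of_le' hn
    rw [← hl, z1_eq_zBasis, show m + 2 - 1 = m + 1 from rfl, zProd1_eq_zBasis, zList_succ]
    refine tendsto_truncMap_doubleShuffle l _ ?_ a _ _
    rw [← PNat.coe_le_coe, Nat.succPNat_coe]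
    change 2 ≤ κ 1 - 1 + 1
    omega
  have hsum := tendsto_finsetSum _ hterm
  rw [Finset.sum_const_zero] at hsum
  rw [e]
  exact hsum.congr fun M => (map_sum (truncMap M) _ _).symm

end MultipleL

end

/-- The summation on the left runs over `l = κ 0` and `k₁ = κ 1, …, k_{n-1} = κ (n - 1)`;
`a_j` is `α j` for `1 ≤ j ≤ n - 1`, and no other value of `α` occurs. The second conjunct
says that the series defining `ℒ_∗` converge. -/
theorem mainTheorem1 (N : ℕ) [NeZero N] (n k : ℕ) (hn : 2 ≤ n) (hk : n + 1 ≤ k)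
    (a : ZMod N) (α : ℕ → ZMod N) :
    (((∑ κ ∈ comps (Finset.Icc 0 (n - 1)) k with 2 ≤ κ 1,
        (calI.symm (shuffleA1 (z1 (κ 0) a) (zProd1 (n - 1) κ α)) -
          harmonicProd (calI.symm (z1 (κ 0) a)) (calI.symm (zProd1 (n - 1) κ α))) : A1 N) : A N) =
      weightedSum n k a α) ∧
    (∀ (j : ℕ+) (b : ZMod N) (w : ZWord N), (2 ≤ j ∨ b ≠ 0) →
      Filter.Tendsto (LStarTrunc ((j, b) :: w)) Filter.atTop
        (nhds (LStarValue ((j, b) :: w)))) ∧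
    ∃ h : weightedSum n k a α ∈ A0 N, (⟨weightedSum n k a α, h⟩ : A0 N) ∈ LinearMap.ker LStar := by
  exact ⟨sum_doubleShuffle_eq_weightedSum n k hn a α, tendsto_LStarTrunc,
    weightedSum_mem_A0 n k hn a α, LStar_weightedSum n k hn a α _⟩
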